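/- **Weitzenböck (Bochner) formula for harmonic maps.** Let $(M,g)$ be a smooth Riemannian manifold (possibly with boundary), let $(N,h)$ be a smooth Riemannian manifold without boundary, and let $f\colon M\to N$ be a harmonic map, i.e. a smooth map with $d_\nabla^\star df=0$, where $\nabla$ is the pullback to $f^*TN$ of the Levi-Civita connection of $N$. In local coordinates $(x^\alpha)$ on $M$ and $(y^k)$ on $N$ this equation reads $$\frac{1}{\sqrt{g}}\,\partial_\alpha\!\left(\sqrt{g}\,g^{\alpha\beta}\,\partial_\beta f^k\right)+g^{\alpha\beta}\,(\Gamma^k_{ij}\circ f)\,\partial_\alpha f^i\,\partial_\beta f^j=0 .$$ Let $e(f)=\tfrac12|df|^2=\tfrac12\, g^{\alpha\beta}\,(h_{ij}\circ f)\,\partial_\alpha f^i\,\partial_\beta f^j$ be the energy density of $f$. Then $e(f)$ is smooth, and at every point $x\in M$ and for every orthonormal basis $(e_\alpha)$ of $T_xM$, $$\Delta e(f)=|\nabla df|^2+\sum_\alpha\big\langle df(\mathrm{Ric}^M(e_\alpha)),\,df(e_\alpha)\big\rangle-\sum_{\alpha,\beta}\big\langle R^N(df(e_\alpha),df(e_\beta))\,df(e_\beta),\,df(e_\alpha)\big\rangle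 .$$ Here $\Delta u=\frac{1}{\sqrt g}\partial_\sigma(\sqrt g\,g^{\sigma\tau}\partial_\tau u)$ is the Laplace–Beltrami operator of $M$; $\nabla df$ is the covariant derivative of $df$ for the connection on $T^*M\otimes f^*TN$ induced by the Levi-Civita connections, and $|\nabla df|^2=\sum_{\alpha,\beta}|\nabla df(e_\alpha,e_\beta)|^2$; $R(X,Y)Z=\nabla_X\nabla_YZ-\nabla_Y\nabla_XZ-\nabla_{[X,Y]}Z$ is the Riemann curvature tensor; and $\mathrm{Ric}^M(X)=\sum_\beta R^M(X,e_\beta)e_\beta$ is the Ricci operator of $M$. -/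

import Mathlib

open Bundle
open scoped Manifold ContDiff

noncomputable section

namespace HarmonicMaps

/-! ## Riemannian geometry of a manifold in a chart

`M` is a manifold of dimension `m` (possibly with boundary or corners), whose tangent spaces carry
inner products. All partial derivatives are taken within `Set.range I`, the model region of the
charts; it is the whole of `ℝᵐ` if there is no boundary. -/

section Chart

variable {m : ℕ} {H : Type*} [TopologicalSpace H]
  (I : ModelWithCorners ℝ (EuclideanSpace ℝ (Fin m)) H)
  {M : Type*} [TopologicalSpace M] [ChartedSpace H M]

/-- The partial derivative `∂F/∂x^α` at `u`. -/
def pderiv (α : Fin m) (F : EuclideanSpace ℝ (Fin m) → ℝ) (u : EuclideanSpace ℝ (Fin m)) : ℝ :=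
  fderivWithin ℝ F (Set.range I) u (EuclideanSpace.single α 1)

variable [IsManifold I 1 M]

/-- The coordinate vector `∂/∂x^α` at the point `x`, for the chart at `x₀`; the trivialization of
the tangent bundle at `x₀` is the one given by the derivative of that chart. -/
def coordVec (x₀ x : M) (α : Fin m) : TangentSpace I x :=
  (trivializationAt (EuclideanSpace ℝ (Fin m)) (TangentSpace I) x₀).symmL ℝ x
    (EuclideanSpace.single α 1)

/-- The component `X^α = dx^α(X)` of a tangent vector `X` at `x`, for the chart at `x₀`. -/
def coordComp (x₀ x : M) (X : TangentSpace I x) (α : Fin m) : ℝ :=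
  ((trivializationAt (EuclideanSpace ℝ (Fin m)) (TangentSpace I) x₀).continuousLinearMapAt ℝ x X :
    EuclideanSpace ℝ (Fin m)) α

variable [RiemannianBundle (fun x : M ↦ TangentSpace I x)]

/-- The matrix `(g_{αβ})` of the metric in the chart at `x₀`, as a function of the coordinates. -/
def metricMatrix (x₀ : M) (u : EuclideanSpace ℝ (Fin m)) : Matrix (Fin m) (Fin m) ℝ :=
  Matrix.of fun α β ↦ inner ℝ (coordVec I x₀ ((extChartAt I x₀).symm u) α)
    (coordVec I x₀ ((extChartAt I x₀).symm u) β)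

/-- The inverse matrix `(g^{αβ})`. -/
def invMetricMatrix (x₀ : M) (u : EuclideanSpace ℝ (Fin m)) : Matrix (Fin m) (Fin m) ℝ :=
  (metricMatrix I x₀ u)⁻¹

/-- The volume density `√(det g_{αβ})`. -/
def sqrtDet (x₀ : M) (u : EuclideanSpace ℝ (Fin m)) : ℝ :=
  √(metricMatrix I x₀ u).det

/-- The Christoffel symbols of the Levi-Civita connection,
`Γ^γ_{αβ} = ½ g^{γδ} (∂_α g_{βδ} + ∂_β g_{αδ} - ∂_δ g_{αβ})`. -/
def christoffel (x₀ : M) (γ α β : Fin m) (u : EuclideanSpace ℝ (Fin m)) : ℝ :=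
  1 / 2 * ∑ δ, invMetricMatrix I x₀ u γ δ *
    (pderiv I α (fun v ↦ metricMatrix I x₀ v β δ) u
      + pderiv I β (fun v ↦ metricMatrix I x₀ v α δ) u
      - pderiv I δ (fun v ↦ metricMatrix I x₀ v α β) u)

/-- The components of the curvature tensor: `R(∂_α, ∂_β) ∂_δ = curvatureCoeff γ δ α β • ∂_γ`, for
the convention `R(X, Y) Z = ∇_X ∇_Y Z - ∇_Y ∇_X Z - ∇_{[X, Y]} Z`. -/
def curvatureCoeff (x₀ : M) (γ δ α β : Fin m) (u : EuclideanSpace ℝ (Fin m)) : ℝ :=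
  pderiv I α (christoffel I x₀ γ β δ) u - pderiv I β (christoffel I x₀ γ α δ) u
    + ∑ η, (christoffel I x₀ γ α η u * christoffel I x₀ η β δ u
      - christoffel I x₀ γ β η u * christoffel I x₀ η α δ u)

/-- The divergence `(1/√g) ∂_σ (√g g^{στ} V_τ)` of a covector field `V_τ dx^τ`
(that is, `-d^* V = ⋆ d ⋆ V`). -/
def divCoord (x₀ : M) (V : EuclideanSpace ℝ (Fin m) → Fin m → ℝ)
    (u : EuclideanSpace ℝ (Fin m)) : ℝ :=
  (sqrtDet I x₀ u)⁻¹ *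
    ∑ σ, pderiv I σ (fun v ↦ sqrtDet I x₀ v * ∑ τ, invMetricMatrix I x₀ v σ τ * V v τ) u

/-- The Laplace-Beltrami operator `Δu = (1/√g) ∂_σ (√g g^{στ} ∂_τ u)`. -/
def laplacian (u : M → ℝ) (x : M) : ℝ :=
  divCoord I x (fun v τ ↦ pderiv I τ (fun w ↦ u ((extChartAt I x).symm w)) v) (extChartAt I x x)

/-- The Riemann curvature tensor `R(X, Y) Z` at `x`; `⟨R(X, Y) Y, X⟩` is the sectional curvature
of an orthonormal pair `X`, `Y`. -/
def curvature (x : M) (X Y Z : TangentSpace I x) : TangentSpace I x :=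
  ∑ γ, (∑ δ, ∑ α, ∑ β, coordComp I x x X α * coordComp I x x Y β * coordComp I x x Z δ *
    curvatureCoeff I x γ δ α β (extChartAt I x x)) • coordVec I x x γ

/-- The Ricci operator `Ric(X) = g^{δε} R(X, ∂_δ) ∂_ε` at `x`. -/
def ricci (x : M) (X : TangentSpace I x) : TangentSpace I x :=
  ∑ δ, ∑ ε, invMetricMatrix I x (extChartAt I x x) δ ε •
    curvature I x X (coordVec I x x δ) (coordVec I x x ε)

end Chart

/-! ## Maps between Riemannian manifolds -/

section Maps

variable {m n : ℕ} {H H' : Type*} [TopologicalSpace H] [TopologicalSpace H']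
  (I : ModelWithCorners ℝ (EuclideanSpace ℝ (Fin m)) H)
  (J : ModelWithCorners ℝ (EuclideanSpace ℝ (Fin n)) H')
  {M : Type*} [TopologicalSpace M] [ChartedSpace H M]
  {N : Type*} [TopologicalSpace N] [ChartedSpace H' N]

/-- The local expression `f^i` of `f`, in the charts at `x₀` and `y₀`. -/
def mapCoord (f : M → N) (x₀ : M) (y₀ : N) (i : Fin n) (u : EuclideanSpace ℝ (Fin m)) : ℝ :=
  extChartAt J y₀ (f ((extChartAt I x₀).symm u)) i

variable [IsManifold I 1 M] [RiemannianBundle (fun x : M ↦ TangentSpace I x)]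
  [IsManifold J 1 N] [RiemannianBundle (fun y : N ↦ TangentSpace J y)]

/-- The energy density `e(f) = ½ |df|²`, with `|df|² = ∑ |df(e_α)|²` for an orthonormal basis
`(e_α)` of the tangent space. -/
def energyDensity (f : M → N) (x : M) : ℝ :=
  haveI : FiniteDimensional ℝ (TangentSpace I x) :=
    inferInstanceAs (FiniteDimensional ℝ (EuclideanSpace ℝ (Fin m)))
  1 / 2 * ∑ α, ‖mfderiv I J f x (stdOrthonormalBasis ℝ (TangentSpace I x) α)‖ ^ 2

/-- The components, with respect to `∂/∂f^k = ∂/∂y^k ∘ f`, of the codifferential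
`d_∇^* θ = - ⋆ d_∇ ⋆ θ` of an `f^*TN`-valued 1-form `θ = θ_β^k dx^β ⊗ ∂/∂f^k`, where
`d_∇ = d + Γ^k_{ij}(f) df^i` is induced by the pullback of the Levi-Civita connection of `N`. -/
def codifferential (f : M → N) (x₀ : M) (y₀ : N)
    (θ : EuclideanSpace ℝ (Fin m) → Fin m → Fin n → ℝ) (k : Fin n)
    (u : EuclideanSpace ℝ (Fin m)) : ℝ :=
  -(divCoord I x₀ (fun v β ↦ θ v β k) u
    + ∑ α, ∑ β, ∑ i, ∑ j, invMetricMatrix I x₀ u α β *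
        christoffel J y₀ k i j (extChartAt J y₀ (f ((extChartAt I x₀).symm u))) *
        pderiv I α (mapCoord I J f x₀ y₀ i) u * θ u β j)

/-- A smooth map is harmonic if `d_∇^* df = 0`, in local coordinates on `M` and `N`. -/
structure IsHarmonicMap (f : M → N) : Prop where
  contMDiff : ContMDiff I J ∞ f
  codifferential_eq_zero : ∀ (x₀ : M) (y₀ : N) (x : M), x ∈ (chartAt H x₀).source →
    f x ∈ (chartAt H' y₀).source → ∀ k : Fin n,
      codifferential I J f x₀ y₀ (fun u β j ↦ pderiv I β (mapCoord I J f x₀ y₀ j) u) k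
        (extChartAt I x₀ x) = 0

/-- The components
`(∇df)^k_{αβ} = ∂_α ∂_β f^k - Γ^γ_{αβ} ∂_γ f^k + Γ^k_{ij}(f) ∂_α f^i ∂_β f^j` of the covariant
derivative of `df` for the connection on `T^*M ⊗ f^*TN` induced by the Levi-Civita connections. -/
def nablaDfCoeff (f : M → N) (x₀ : M) (y₀ : N) (k : Fin n) (α β : Fin m)
    (u : EuclideanSpace ℝ (Fin m)) : ℝ :=
  pderiv I α (pderiv I β (mapCoord I J f x₀ y₀ k)) u
    - ∑ γ, christoffel I x₀ γ α β u * pderiv I γ (mapCoord I J f x₀ y₀ k) u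
    + ∑ i, ∑ j, christoffel J y₀ k i j (extChartAt J y₀ (f ((extChartAt I x₀).symm u))) *
        pderiv I α (mapCoord I J f x₀ y₀ i) u * pderiv I β (mapCoord I J f x₀ y₀ j) u

/-- The covariant derivative `∇df(X, Y)` at `x`, an element of the tangent space of `N` at
`f x`. -/
def nablaDf (f : M → N) (x : M) (X Y : TangentSpace I x) : TangentSpace J (f x) :=
  ∑ k, (∑ α, ∑ β, coordComp I x x X α * coordComp I x x Y β *
    nablaDfCoeff I J f x (f x) k α β (extChartAt I x x)) • coordVec J (f x) (f x) k

/-- `|∇df|² = ∑ |∇df(e_α, e_β)|²` for an orthonormal basis `(e_α)` of the tangent space. -/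
def nablaDfNormSq (f : M → N) (x : M) : ℝ :=
  haveI : FiniteDimensional ℝ (TangentSpace I x) :=
    inferInstanceAs (FiniteDimensional ℝ (EuclideanSpace ℝ (Fin m)))
  ∑ α, ∑ β, ‖nablaDf I J f x (stdOrthonormalBasis ℝ (TangentSpace I x) α)
    (stdOrthonormalBasis ℝ (TangentSpace I x) β)‖ ^ 2

end Maps

end HarmonicMaps

end

/-! The formula is the classical Bochner argument. Metric connections give `∂_σ e(f) = ⟨∇_σ df,
df⟩`. Taking one more divergence gives `Δ e(f) = |∇df|² + ⟨div ∇df, df⟩`, so only the divergence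
`g^{ρσ} ∇_ρ ∇_σ df` has to be understood.

Both connections are torsion-free, so `∇df` is symmetric and `(∇_ρ ∇df)(∂_σ, ∂_α) = (∇_ρ ∇df)(∂_α,
∂_σ)`. Exchanging `∇_ρ` with `∇_α` costs a curvature term of `T^*M ⊗ f^*TN`. What remains is the
covariant derivative in direction `α` of the trace `g^{ρσ} (∇df)_{ρσ}`. This trace is the tension
field; it vanishes on a whole neighbourhood, so its derivative vanishes too. The curvature of the
pullback connection is the pullback of `R^N`, and the curvature of `T^*M` contracts to the Ricci
operator.

All of this is done in one fixed pair of charts, with matrices of functions: the differential is a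
matrix `φ`, the connections are matrices `A α` (on `f^*TN`) and `Γ α` (on `TM`), and inner products
are traces `tr(Xᵀ h Y g)` with `g` the inverse metric. The abstract computation is
`matCovDeriv_comm`, `pderiv_trace_pairing`, `div_matCovDeriv` and `laplacian_trace_pairing`. Its
hypotheses are supplied by `matDeriv_metricMatrix_comp`, `matDeriv_invMetricMatrix`,
`matCovDeriv_dfMatrix_symm` and `IsHarmonicMap.sum_matCovDeriv_eq_zero`. `divCoord_eq` rewrites the
Laplacian covariantly, and the lemmas `nablaDfNormSq_eq`, `sum_inner_ricci` and
`sum_inner_curvature` turn sums over orthonormal bases into contractions with `g`. -/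

noncomputable section

namespace HarmonicMaps

/-! ## Partial derivatives within the model region -/

section Calculus

open Matrix Set Filter Topology

variable {m : ℕ} {H : Type*} [TopologicalSpace H]
  {I : ModelWithCorners ℝ (EuclideanSpace ℝ (Fin m)) H}

/-- `U` is a relatively open subset of the model region `Set.range I`. -/
structure RelOpen (I : ModelWithCorners ℝ (EuclideanSpace ℝ (Fin m)) H) (U : Set (EuclideanSpace ℝ (Fin m))) : Prop where
  subset : U ⊆ range I
  mem_nhdsWithin : ∀ u ∈ U, U ∈ 𝓝[range I] u

/-- Smoothness on `U`, within the model region. -/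
def SmoothIn (I : ModelWithCorners ℝ (EuclideanSpace ℝ (Fin m)) H) (U : Set (EuclideanSpace ℝ (Fin m))) (F : EuclideanSpace ℝ (Fin m) → ℝ) :
    Prop :=
  ∀ u ∈ U, ContDiffWithinAt ℝ ∞ F (range I) u

variable {U : Set (EuclideanSpace ℝ (Fin m))} {F G : EuclideanSpace ℝ (Fin m) → ℝ} {u : EuclideanSpace ℝ (Fin m)}

theorem pderiv_congr (hU : RelOpen I U) (hu : u ∈ U) (h : ∀ v ∈ U, F v = G v) (α : Fin m) :
    pderiv I α F u = pderiv I α G u := by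
  unfold pderiv
  rw [Filter.EventuallyEq.fderivWithin_eq (f := G) _ (h u hu)]
  filter_upwards [hU.mem_nhdsWithin u hu] with v hv using h v hv

namespace SmoothIn

theorem congr (hU : RelOpen I U) (hF : SmoothIn I U F) (h : ∀ v ∈ U, G v = F v) :
    SmoothIn I U G := fun u hu ↦
  (hF u hu).congr_of_eventuallyEq
    (by filter_upwards [hU.mem_nhdsWithin u hu] with v hv using h v hv) (h u hu)

theorem differentiableWithinAt (hF : SmoothIn I U F) (hu : u ∈ U) :
    DifferentiableWithinAt ℝ F (range I) u :=
  (hF u hu).differentiableWithinAt (by simp)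

theorem const (c : ℝ) : SmoothIn I U (fun _ ↦ c) := fun _ _ ↦ contDiffWithinAt_const

theorem add (hF : SmoothIn I U F) (hG : SmoothIn I U G) : SmoothIn I U (fun v ↦ F v + G v) :=
  fun u hu ↦ (hF u hu).add (hG u hu)

theorem sub (hF : SmoothIn I U F) (hG : SmoothIn I U G) : SmoothIn I U (fun v ↦ F v - G v) :=
  fun u hu ↦ (hF u hu).sub (hG u hu)

theorem mul (hF : SmoothIn I U F) (hG : SmoothIn I U G) : SmoothIn I U (fun v ↦ F v * G v) :=
  fun u hu ↦ (hF u hu).mul (hG u hu)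

theorem sum {ι : Type*} {s : Finset ι} {F : ι → EuclideanSpace ℝ (Fin m) → ℝ} (hF : ∀ i ∈ s, SmoothIn I U (F i)) :
    SmoothIn I U (fun v ↦ ∑ i ∈ s, F i v) :=
  fun u hu ↦ ContDiffWithinAt.sum fun i hi ↦ hF i hi u hu

theorem prod {ι : Type*} {s : Finset ι} {F : ι → EuclideanSpace ℝ (Fin m) → ℝ} (hF : ∀ i ∈ s, SmoothIn I U (F i)) :
    SmoothIn I U (fun v ↦ ∏ i ∈ s, F i v) :=
  fun u hu ↦ contDiffWithinAt_prod fun i hi ↦ hF i hi u hu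

theorem inv (hF : SmoothIn I U F) (h : ∀ v ∈ U, F v ≠ 0) : SmoothIn I U (fun v ↦ (F v)⁻¹) :=
  fun u hu ↦ (hF u hu).inv (h u hu)

theorem sqrt (hF : SmoothIn I U F) (h : ∀ v ∈ U, F v ≠ 0) : SmoothIn I U (fun v ↦ √(F v)) :=
  fun u hu ↦ (hF u hu).sqrt (h u hu)

theorem pderiv (hU : RelOpen I U) (hF : SmoothIn I U F) (α : Fin m) :
    SmoothIn I U (pderiv I α F) := fun u hu ↦
  ((hF u hu).fderivWithin_right I.uniqueDiffOn (by simp) (hU.subset hu)).clm_apply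
    contDiffWithinAt_const

end SmoothIn

theorem RelOpen.uniqueDiffWithinAt (hU : RelOpen I U) (hu : u ∈ U) :
    UniqueDiffWithinAt ℝ (range I) u := I.uniqueDiffOn u (hU.subset hu)

theorem pderiv_add (hU : RelOpen I U) (hF : SmoothIn I U F) (hG : SmoothIn I U G) (hu : u ∈ U)
    (α : Fin m) : pderiv I α (fun v ↦ F v + G v) u = pderiv I α F u + pderiv I α G u := by
  unfold pderiv
  rw [fderivWithin_fun_add (hU.uniqueDiffWithinAt hu) (hF.differentiableWithinAt hu)
    (hG.differentiableWithinAt hu)]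
  rfl

theorem pderiv_sub (hU : RelOpen I U) (hF : SmoothIn I U F) (hG : SmoothIn I U G) (hu : u ∈ U)
    (α : Fin m) : pderiv I α (fun v ↦ F v - G v) u = pderiv I α F u - pderiv I α G u := by
  unfold pderiv
  rw [fderivWithin_fun_sub (hU.uniqueDiffWithinAt hu) (hF.differentiableWithinAt hu)
    (hG.differentiableWithinAt hu)]
  rfl

theorem pderiv_mul (hU : RelOpen I U) (hF : SmoothIn I U F) (hG : SmoothIn I U G) (hu : u ∈ U)
    (α : Fin m) :
    pderiv I α (fun v ↦ F v * G v) u = pderiv I α F u * G u + F u * pderiv I α G u := by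
  unfold pderiv
  rw [fderivWithin_fun_mul (hU.uniqueDiffWithinAt hu) (hF.differentiableWithinAt hu)
    (hG.differentiableWithinAt hu)]
  simp
  ring

theorem pderiv_const (c : ℝ) (α : Fin m) : pderiv I α (fun _ ↦ c) u = 0 := by
  simp [pderiv]

theorem pderiv_const_mul (hU : RelOpen I U) (hF : SmoothIn I U F) (hu : u ∈ U) (c : ℝ)
    (α : Fin m) : pderiv I α (fun v ↦ c * F v) u = c * pderiv I α F u := by
  rw [pderiv_mul hU (SmoothIn.const c) hF hu, pderiv_const]
  ring

theorem pderiv_sum (hU : RelOpen I U) {ι : Type*} {s : Finset ι} {F : ι → EuclideanSpace ℝ (Fin m) → ℝ}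
    (hF : ∀ i ∈ s, SmoothIn I U (F i)) (hu : u ∈ U) (α : Fin m) :
    pderiv I α (fun v ↦ ∑ i ∈ s, F i v) u = ∑ i ∈ s, pderiv I α (F i) u := by
  unfold pderiv
  rw [fderivWithin_fun_sum (hU.uniqueDiffWithinAt hu)
    fun i hi ↦ (hF i hi).differentiableWithinAt hu]
  simp

theorem pderiv_prod (hU : RelOpen I U) {ι : Type*} [DecidableEq ι] {s : Finset ι} {F : ι → EuclideanSpace ℝ (Fin m) → ℝ}
    (hF : ∀ i ∈ s, SmoothIn I U (F i)) (hu : u ∈ U) (α : Fin m) :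
    pderiv I α (fun v ↦ ∏ i ∈ s, F i v) u
      = ∑ i ∈ s, (∏ j ∈ s.erase i, F j u) * pderiv I α (F i) u := by
  unfold pderiv
  rw [fderivWithin_finsetProd (hU.uniqueDiffWithinAt hu)
    fun i hi ↦ (hF i hi).differentiableWithinAt hu]
  simp

theorem pderiv_comm (hU : RelOpen I U) (hF : SmoothIn I U F) (hu : u ∈ U) (α β : Fin m) :
    pderiv I α (pderiv I β F) u = pderiv I β (pderiv I α F) u := by
  have hur := hU.subset hu
  have hd : DifferentiableWithinAt ℝ (fderivWithin ℝ F (range I)) (range I) u :=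
    ((hF u hu).fderivWithin_right (m := ∞) I.uniqueDiffOn (by simp) hur).differentiableWithinAt
      (by simp)
  have key (a b : Fin m) : pderiv I a (pderiv I b F) u
      = fderivWithin ℝ (fderivWithin ℝ F (range I)) (range I) u (EuclideanSpace.single a 1)
        (EuclideanSpace.single b 1) := by
    have := fderivWithin_clm_apply (hU.uniqueDiffWithinAt hu) hd
      (differentiableWithinAt_const (EuclideanSpace.single b (1 : ℝ)))
    change fderivWithin ℝ (fun v ↦ fderivWithin ℝ F (range I) v (EuclideanSpace.single b 1))
      (range I) u _ = _
    rw [this]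
    simp
  rw [key, key]
  -- Symmetry of the second derivative persists at boundary points because the model region lies in
  -- the closure of its interior.
  exact ((hF u hu).isSymmSndFDerivWithinAt
    (by rw [minSmoothness_of_isRCLikeNormedField]; exact ENat.LEInfty.out) I.uniqueDiffOn
    (I.range_subset_closure_interior hur) hur).eq _ _

theorem pderiv_sqrt (hU : RelOpen I U) (hF : SmoothIn I U F) (h : ∀ v ∈ U, 0 < F v) (hu : u ∈ U)
    (α : Fin m) : pderiv I α (fun v ↦ √(F v)) u = (2 * √(F u))⁻¹ * pderiv I α F u := by
  have hs : SmoothIn I U (fun v ↦ √(F v)) := hF.sqrt fun v hv ↦ (h v hv).ne'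
  -- The derivative of the root is found by differentiating `F = √F · √F` and solving.
  have h1 : pderiv I α F u = pderiv I α (fun v ↦ √(F v) * √(F v)) u :=
    pderiv_congr hU hu (fun v hv ↦ (Real.mul_self_sqrt (h v hv).le).symm) α
  rw [h1, pderiv_mul hU hs hs hu]
  have := Real.sqrt_pos.2 (h u hu)
  field_simp
  ring

/-! ### Matrices of functions -/

variable {a b c : Type*}

/-- The entrywise partial derivative. -/
def matDeriv (I : ModelWithCorners ℝ (EuclideanSpace ℝ (Fin m)) H) (α : Fin m)
    (X : EuclideanSpace ℝ (Fin m) → Matrix a b ℝ) (u : EuclideanSpace ℝ (Fin m)) : Matrix a b ℝ :=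
  Matrix.of fun i j ↦ pderiv I α (fun v ↦ X v i j) u

/-- Entrywise smoothness. -/
def MatSmooth (I : ModelWithCorners ℝ (EuclideanSpace ℝ (Fin m)) H) (U : Set (EuclideanSpace ℝ (Fin m)))
    (X : EuclideanSpace ℝ (Fin m) → Matrix a b ℝ) : Prop :=
  ∀ i j, SmoothIn I U (fun v ↦ X v i j)

theorem matDeriv_apply (α : Fin m) (X : EuclideanSpace ℝ (Fin m) → Matrix a b ℝ) (i : a) (j : b) :
    matDeriv I α X u i j = pderiv I α (fun v ↦ X v i j) u := rfl

theorem matDeriv_congr {X Y : EuclideanSpace ℝ (Fin m) → Matrix a b ℝ} (hU : RelOpen I U) (hu : u ∈ U)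
    (h : ∀ v ∈ U, X v = Y v) (α : Fin m) : matDeriv I α X u = matDeriv I α Y u := by
  ext i j
  exact pderiv_congr hU hu (fun v hv ↦ by rw [h v hv]) α

namespace MatSmooth

variable {X Y : EuclideanSpace ℝ (Fin m) → Matrix a b ℝ}

theorem congr (hU : RelOpen I U) (hX : MatSmooth I U X) (h : ∀ v ∈ U, Y v = X v) :
    MatSmooth I U Y := fun i j ↦ (hX i j).congr hU fun v hv ↦ by rw [h v hv]

theorem add (hX : MatSmooth I U X) (hY : MatSmooth I U Y) : MatSmooth I U (fun v ↦ X v + Y v) :=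
  fun i j ↦ (hX i j).add (hY i j)

theorem sub (hX : MatSmooth I U X) (hY : MatSmooth I U Y) : MatSmooth I U (fun v ↦ X v - Y v) :=
  fun i j ↦ (hX i j).sub (hY i j)

theorem transpose (hX : MatSmooth I U X) : MatSmooth I U (fun v ↦ (X v)ᵀ) :=
  fun i j ↦ hX j i

theorem mul [Fintype b] {Z : EuclideanSpace ℝ (Fin m) → Matrix b c ℝ} (hX : MatSmooth I U X) (hZ : MatSmooth I U Z) :
    MatSmooth I U (fun v ↦ X v * Z v) := fun i j ↦ by
  simp only [Matrix.mul_apply]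
  exact .sum fun k _ ↦ (hX i k).mul (hZ k j)

theorem matDeriv (hU : RelOpen I U) (hX : MatSmooth I U X) (α : Fin m) :
    MatSmooth I U (matDeriv I α X) := fun i j ↦ (hX i j).pderiv hU α

theorem trace [Fintype a] {X : EuclideanSpace ℝ (Fin m) → Matrix a a ℝ} (hX : MatSmooth I U X) :
    SmoothIn I U (fun v ↦ (X v).trace) := .sum fun i _ ↦ hX i i

theorem det [Fintype a] [DecidableEq a] {X : EuclideanSpace ℝ (Fin m) → Matrix a a ℝ} (hX : MatSmooth I U X) :
    SmoothIn I U (fun v ↦ (X v).det) := by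
  simp only [Matrix.det_apply, Units.smul_def, zsmul_eq_mul]
  exact .sum fun σ _ ↦ (SmoothIn.const _).mul (.prod fun i _ ↦ hX _ _)

/-- Each entry is a determinant of the matrix with one row replaced by a constant one; with
`Matrix.inv_def` this makes the inverse smooth. -/
theorem adjugate [Fintype a] [DecidableEq a] {X : EuclideanSpace ℝ (Fin m) → Matrix a a ℝ} (hX : MatSmooth I U X) :
    MatSmooth I U (fun v ↦ (X v).adjugate) := fun i j ↦ by
  simp only [Matrix.adjugate_apply]
  refine MatSmooth.det (X := fun v ↦ (X v).updateRow j (Pi.single i 1)) fun k l ↦ ?_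
  by_cases hk : k = j
  · subst hk
    simpa using SmoothIn.const _
  · simpa [Matrix.updateRow_ne hk] using hX k l

theorem inv [Fintype a] [DecidableEq a] {X : EuclideanSpace ℝ (Fin m) → Matrix a a ℝ} (hX : MatSmooth I U X)
    (h : ∀ v ∈ U, (X v).det ≠ 0) : MatSmooth I U (fun v ↦ (X v)⁻¹) := fun i j ↦ by
  simp only [Matrix.inv_def, Ring.inverse_eq_inv', Matrix.smul_apply, smul_eq_mul]
  exact (hX.det.inv h).mul (hX.adjugate i j)

end MatSmooth

section

variable {X Y : EuclideanSpace ℝ (Fin m) → Matrix a b ℝ} (hU : RelOpen I U)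
include hU

theorem matDeriv_add (hX : MatSmooth I U X) (hY : MatSmooth I U Y) (hu : u ∈ U) (α : Fin m) :
    matDeriv I α (fun v ↦ X v + Y v) u = matDeriv I α X u + matDeriv I α Y u := by
  ext i j
  exact pderiv_add hU (hX i j) (hY i j) hu α

theorem matDeriv_sub (hX : MatSmooth I U X) (hY : MatSmooth I U Y) (hu : u ∈ U) (α : Fin m) :
    matDeriv I α (fun v ↦ X v - Y v) u = matDeriv I α X u - matDeriv I α Y u := by
  ext i j
  exact pderiv_sub hU (hX i j) (hY i j) hu α

theorem matDeriv_mul [Fintype b] {Z : EuclideanSpace ℝ (Fin m) → Matrix b c ℝ} (hX : MatSmooth I U X)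
    (hZ : MatSmooth I U Z) (hu : u ∈ U) (α : Fin m) :
    matDeriv I α (fun v ↦ X v * Z v) u = matDeriv I α X u * Z u + X u * matDeriv I α Z u := by
  ext i j
  simp only [matDeriv_apply, Matrix.mul_apply, Matrix.add_apply]
  rw [pderiv_sum hU (fun k _ ↦ (hX i k).mul (hZ k j)) hu, ← Finset.sum_add_distrib]
  exact Finset.sum_congr rfl fun k _ ↦ pderiv_mul hU (hX i k) (hZ k j) hu α

theorem pderiv_trace [Fintype a] {X : EuclideanSpace ℝ (Fin m) → Matrix a a ℝ} (hX : MatSmooth I U X) (hu : u ∈ U)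
    (α : Fin m) : pderiv I α (fun v ↦ (X v).trace) u = (matDeriv I α X u).trace :=
  pderiv_sum hU (fun i _ ↦ hX i i) hu α

theorem matDeriv_comm (hX : MatSmooth I U X) (hu : u ∈ U) (α β : Fin m) :
    matDeriv I α (matDeriv I β X) u = matDeriv I β (matDeriv I α X) u := by
  ext i j
  exact pderiv_comm hU (hX i j) hu α β

theorem matDeriv_inv [Fintype a] [DecidableEq a] {X : EuclideanSpace ℝ (Fin m) → Matrix a a ℝ} (hX : MatSmooth I U X)
    (h : ∀ v ∈ U, (X v).det ≠ 0) (hu : u ∈ U) (α : Fin m) :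
    matDeriv I α (fun v ↦ (X v)⁻¹) u = -((X u)⁻¹ * matDeriv I α X u * (X u)⁻¹) := by
  have hd : IsUnit (X u).det := (h u hu).isUnit
  -- Differentiate `X X⁻¹ = 1` and multiply by `X⁻¹` on the left.
  have h1 : matDeriv I α (fun v ↦ X v * (X v)⁻¹) u = 0 := by
    rw [matDeriv_congr (Y := fun _ ↦ 1) hU hu
      (fun v hv ↦ Matrix.mul_nonsing_inv _ (h v hv).isUnit)]
    ext i j
    exact pderiv_const _ α
  rw [matDeriv_mul hU hX (hX.inv h) hu] at h1
  have h2 := congrArg (fun Z ↦ (X u)⁻¹ * Z) h1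
  simp only [Matrix.mul_add, Matrix.mul_zero, ← Matrix.mul_assoc, Matrix.nonsing_inv_mul _ hd,
    Matrix.one_mul] at h2
  exact eq_neg_of_add_eq_zero_right h2

/-- Jacobi's formula for the derivative of a determinant. -/
theorem pderiv_det [Fintype a] [DecidableEq a] {X : EuclideanSpace ℝ (Fin m) → Matrix a a ℝ} (hX : MatSmooth I U X)
    (hu : u ∈ U) (α : Fin m) :
    pderiv I α (fun v ↦ (X v).det) u = ((X u).adjugate * matDeriv I α X u).trace := by
  have h1 : pderiv I α (fun v ↦ (X v).det) u = ∑ σ : Equiv.Perm a, (Equiv.Perm.sign σ : ℝ) *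
      ∑ i, (∏ j ∈ Finset.univ.erase i, X u (σ j) j) * matDeriv I α X u (σ i) i := by
    simp only [Matrix.det_apply, Units.smul_def, zsmul_eq_mul]
    rw [pderiv_sum hU (fun σ _ ↦ (SmoothIn.const _).mul (.prod fun i _ ↦ hX _ _)) hu]
    refine Finset.sum_congr rfl fun σ _ ↦ ?_
    rw [pderiv_const_mul hU (.prod fun i _ ↦ hX _ _) hu, pderiv_prod hU (fun i _ ↦ hX _ _) hu]
    rfl
  rw [h1]
  simp only [Finset.mul_sum]
  rw [Finset.sum_comm, Matrix.trace]
  refine Finset.sum_congr rfl fun i _ ↦ ?_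
  -- Cramer's rule: a diagonal entry of `adj(X) ∂X` is the determinant of `X` with column `i`
  -- differentiated, which matches the terms of the Leibniz expansion whose `i`-th factor is
  -- differentiated.
  have h2 : ((X u).adjugate * matDeriv I α X u) i i
      = ((X u).updateCol i (fun k ↦ matDeriv I α X u k i)).det := by
    rw [← Matrix.cramer_apply, Matrix.cramer_eq_adjugate_mulVec]
    rfl
  rw [Matrix.diag_apply, h2, Matrix.det_apply]
  refine Finset.sum_congr rfl fun σ _ ↦ ?_
  rw [Units.smul_def, zsmul_eq_mul, ← Finset.prod_erase_mul _ _ (Finset.mem_univ i)]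
  simp only [Matrix.updateCol_self]
  congr 2
  refine Finset.prod_congr rfl fun j hj ↦ ?_
  rw [Matrix.updateCol_ne (Finset.ne_of_mem_erase hj)]

end

end Calculus

/-! ## Matrix-valued covariant derivatives and the Bochner computation -/

section Bochner

open Matrix Set Filter Topology

variable {m : ℕ} {H : Type*} [TopologicalSpace H]
  {I : ModelWithCorners ℝ (EuclideanSpace ℝ (Fin m)) H}
  {U : Set (EuclideanSpace ℝ (Fin m))} {u : EuclideanSpace ℝ (Fin m)}
  {a b : Type*} [Fintype a] [Fintype b]

/-- The covariant derivative of a matrix of functions, for the connection matrices `A` acting on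
its columns and `Γ` acting dually on its rows. -/
def matCovDeriv (I : ModelWithCorners ℝ (EuclideanSpace ℝ (Fin m)) H)
    (A : Fin m → EuclideanSpace ℝ (Fin m) → Matrix a a ℝ)
    (Γ : Fin m → EuclideanSpace ℝ (Fin m) → Matrix b b ℝ) (α : Fin m)
    (X : EuclideanSpace ℝ (Fin m) → Matrix a b ℝ) (u : EuclideanSpace ℝ (Fin m)) : Matrix a b ℝ :=
  matDeriv I α X u + A α u * X u - X u * Γ α u

/-- The curvature matrix of the connection matrices `A`. -/
def curvMatrix (I : ModelWithCorners ℝ (EuclideanSpace ℝ (Fin m)) H)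
    (A : Fin m → EuclideanSpace ℝ (Fin m) → Matrix a a ℝ) (α β : Fin m)
    (u : EuclideanSpace ℝ (Fin m)) : Matrix a a ℝ :=
  matDeriv I α (A β) u - matDeriv I β (A α) u + (A α u * A β u - A β u * A α u)

variable {A : Fin m → EuclideanSpace ℝ (Fin m) → Matrix a a ℝ}
  {Γ : Fin m → EuclideanSpace ℝ (Fin m) → Matrix b b ℝ}
  {X Y : EuclideanSpace ℝ (Fin m) → Matrix a b ℝ}
  {h : EuclideanSpace ℝ (Fin m) → Matrix a a ℝ} {g : EuclideanSpace ℝ (Fin m) → Matrix b b ℝ}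

theorem MatSmooth.matCovDeriv (hU : RelOpen I U) (hA : ∀ α, MatSmooth I U (A α))
    (hΓ : ∀ α, MatSmooth I U (Γ α)) (hX : MatSmooth I U X) (α : Fin m) :
    MatSmooth I U (matCovDeriv I A Γ α X) :=
  ((hX.matDeriv hU α).add ((hA α).mul hX)).sub (hX.mul (hΓ α))

/-- The commutator of covariant derivatives is given by the curvature. -/
theorem matCovDeriv_comm (hU : RelOpen I U) (hA : ∀ α, MatSmooth I U (A α))
    (hΓ : ∀ α, MatSmooth I U (Γ α)) (hX : MatSmooth I U X) (hu : u ∈ U) (α β : Fin m) :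
    matCovDeriv I A Γ α (matCovDeriv I A Γ β X) u
      = matCovDeriv I A Γ β (matCovDeriv I A Γ α X) u
        + (curvMatrix I A α β u * X u - X u * curvMatrix I Γ α β u) := by
  have key (α β : Fin m) : matDeriv I α (matCovDeriv I A Γ β X) u
      = matDeriv I α (matDeriv I β X) u + (matDeriv I α (A β) u * X u + A β u * matDeriv I α X u)
        - (matDeriv I α X u * Γ β u + X u * matDeriv I α (Γ β) u) := by
    unfold matCovDeriv
    rw [matDeriv_sub hU ((hX.matDeriv hU β).add ((hA β).mul hX)) (hX.mul (hΓ β)) hu,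
      matDeriv_add hU (hX.matDeriv hU β) ((hA β).mul hX) hu, matDeriv_mul hU (hA β) hX hu,
      matDeriv_mul hU hX (hΓ β) hu]
  rw [matCovDeriv, matCovDeriv.eq_def I A Γ β (matCovDeriv I A Γ α X) u, key, key,
    matDeriv_comm hU hX hu α β]
  simp only [matCovDeriv, curvMatrix, Matrix.mul_add, Matrix.mul_sub, Matrix.add_mul,
    Matrix.sub_mul, Matrix.mul_assoc]
  abel

/-- The Leibniz rule for the inner product of matrices defined by compatible metrics. -/
theorem pderiv_trace_pairing (hU : RelOpen I U) (hX : MatSmooth I U X) (hY : MatSmooth I U Y)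
    (hh : MatSmooth I U h) (hg : MatSmooth I U g) (hu : u ∈ U) (α : Fin m)
    (hAh : matDeriv I α h u = (A α u)ᵀ * h u + h u * A α u)
    (hΓg : matDeriv I α g u = -(g u * (Γ α u)ᵀ) - Γ α u * g u) :
    pderiv I α (fun v ↦ ((X v)ᵀ * h v * Y v * g v).trace) u
      = ((matCovDeriv I A Γ α X u)ᵀ * h u * Y u * g u).trace
        + ((X u)ᵀ * h u * matCovDeriv I A Γ α Y u * g u).trace := by
  have hX' := hX.transpose
  rw [pderiv_trace hU (((hX'.mul hh).mul hY).mul hg) hu, matDeriv_mul hU ((hX'.mul hh).mul hY) hg hu,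
    matDeriv_mul hU (hX'.mul hh) hY hu, matDeriv_mul hU hX' hh hu, hAh, hΓg]
  have ht : matDeriv I α (fun v ↦ (X v)ᵀ) u = (matDeriv I α X u)ᵀ := rfl
  -- Cyclicity of the trace moves the left half of `∂g` to the front, where it becomes the `Γ` term
  -- of `(∇X)ᵀ`; the other half belongs to `∇Y`.
  have hc : ((X u)ᵀ * h u * Y u * (g u * (Γ α u)ᵀ)).trace
      = ((Γ α u)ᵀ * (X u)ᵀ * h u * Y u * g u).trace := by
    rw [← Matrix.mul_assoc, Matrix.trace_mul_comm]
    simp only [Matrix.mul_assoc]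
  rw [ht]
  simp only [matCovDeriv, Matrix.transpose_add, Matrix.transpose_sub, Matrix.transpose_mul,
    Matrix.add_mul, Matrix.sub_mul, Matrix.mul_add, Matrix.mul_sub, Matrix.trace_add,
    Matrix.trace_sub, Matrix.mul_neg, Matrix.trace_neg, hc]
  simp only [Matrix.mul_assoc]
  ring

/-- This form displays the pairing as linear in the entries of `X`, so that sums over further
indices can be moved inside it. -/
theorem trace_transpose_mul_mul_mul (X : Matrix a b ℝ) (h : Matrix a a ℝ) (Y : Matrix a b ℝ)
    (g : Matrix b b ℝ) : (Xᵀ * h * Y * g).trace = ∑ i, ∑ α, X i α * (h * Y * g) i α := by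
  simp only [Matrix.mul_assoc, Matrix.trace, Matrix.diag_apply]
  rw [Finset.sum_comm]
  simp only [Matrix.mul_apply (M := Xᵀ), Matrix.transpose_apply]

theorem trace_pairing_comm {h : Matrix a a ℝ} {g : Matrix b b ℝ} (hh : hᵀ = h) (hg : gᵀ = g)
    (X Y : Matrix a b ℝ) : (Xᵀ * h * Y * g).trace = (Yᵀ * h * X * g).trace := by
  rw [← Matrix.trace_transpose]
  simp only [Matrix.transpose_mul, Matrix.transpose_transpose, hh, hg]
  rw [Matrix.trace_mul_comm]
  simp only [Matrix.mul_assoc]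

variable {Γ : Fin m → EuclideanSpace ℝ (Fin m) → Matrix (Fin m) (Fin m) ℝ}
  {g : EuclideanSpace ℝ (Fin m) → Matrix (Fin m) (Fin m) ℝ}
  {φ : EuclideanSpace ℝ (Fin m) → Matrix a (Fin m) ℝ}

/-- The divergence of the second covariant derivative of a harmonic map is a curvature term. -/
theorem div_matCovDeriv (hU : RelOpen I U) (hA : ∀ α, MatSmooth I U (A α))
    (hΓ : ∀ α, MatSmooth I U (Γ α)) (hφ : MatSmooth I U φ) (hg : MatSmooth I U g)
    (hΓg : ∀ α, ∀ v ∈ U, matDeriv I α g v = -(g v * (Γ α v)ᵀ) - Γ α v * g v)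
    (hΓs : ∀ v ∈ U, ∀ α β γ, Γ α v γ β = Γ β v γ α)
    (hφs : ∀ v ∈ U, ∀ α β i, matCovDeriv I A Γ α φ v i β = matCovDeriv I A Γ β φ v i α)
    (hharm : ∀ v ∈ U, ∀ i, ∑ α, ∑ β, g v α β * matCovDeriv I A Γ α φ v i β = 0)
    (hu : u ∈ U) (i : a) (α : Fin m) :
    ∑ ρ, ∑ σ, g u ρ σ * (matCovDeriv I A Γ ρ (matCovDeriv I A Γ σ φ) u i α
        - ∑ γ, Γ ρ u γ σ * matCovDeriv I A Γ γ φ u i α)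
      = ∑ ρ, ∑ σ, g u ρ σ *
          (curvMatrix I A ρ α u * φ u - φ u * curvMatrix I Γ ρ α u) i σ := by
  set B := fun α ↦ matCovDeriv I A Γ α φ with hB
  have hBs : ∀ α, MatSmooth I U (B α) := fun α ↦ hφ.matCovDeriv hU hA hΓ α
  have hg' (ρ σ) : pderiv I α (fun v ↦ g v ρ σ) u
      = -(∑ γ, g u ρ γ * Γ α u σ γ) - ∑ γ, Γ α u ρ γ * g u γ σ := by
    have := congrFun (congrFun (hΓg α u hu) ρ) σ
    simpa [matDeriv_apply, Matrix.mul_apply] using this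
  -- the derivative of the trace
  have h0 : ∑ ρ, ∑ σ, g u ρ σ * (matCovDeriv I A Γ α (B ρ) u i σ
      - ∑ γ, Γ α u γ ρ * B γ u i σ) = 0 := by
    have h1 : pderiv I α (fun v ↦ ∑ ρ, ∑ σ, g v ρ σ * B ρ v i σ) u = 0 := by
      rw [pderiv_congr (G := fun _ ↦ 0) hU hu (fun v hv ↦ hharm v hv i), pderiv_const]
    rw [pderiv_sum hU (fun ρ _ ↦ .sum fun σ _ ↦ (hg ρ σ).mul (hBs ρ i σ)) hu] at h1
    simp only [pderiv_sum hU (fun σ _ ↦ (hg _ σ).mul (hBs _ i σ)) hu,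
      pderiv_mul hU (hg _ _) (hBs _ i _) hu, hg'] at h1
    -- The connection term of `f^*TN` acts on the tension field itself, which is zero.
    have h2 : ∑ ρ, ∑ σ, g u ρ σ * (A α u * B ρ u) i σ = 0 := by
      have (j : a) : ∑ ρ, ∑ σ, g u ρ σ * B ρ u j σ = 0 := hharm u hu j
      calc _ = ∑ j, A α u i j * ∑ ρ, ∑ σ, g u ρ σ * B ρ u j σ := by
            simp only [Matrix.mul_apply, Finset.mul_sum]
            exact Finset.sum_comm_cycle.trans <| Finset.sum_congr rfl fun j _ ↦
              Finset.sum_congr rfl fun ρ _ ↦ Finset.sum_congr rfl fun σ _ ↦ by ring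
        _ = 0 := by simp [this]
    -- The two halves of `∂_α g^{ρσ}` are, after renaming indices, the Christoffel corrections for
    -- `σ` (here) and for `ρ` (next).
    have h3 : ∑ ρ, ∑ σ, (∑ γ, g u ρ γ * Γ α u σ γ) * B ρ u i σ
        = ∑ ρ, ∑ σ, g u ρ σ * ∑ γ, B ρ u i γ * Γ α u γ σ := by
      refine Finset.sum_congr rfl fun ρ _ ↦ ?_
      simp only [Finset.mul_sum, Finset.sum_mul]
      rw [Finset.sum_comm]
      exact Finset.sum_congr rfl fun σ _ ↦ Finset.sum_congr rfl fun γ _ ↦ by ring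
    have h4 : ∑ ρ, ∑ σ, (∑ γ, Γ α u ρ γ * g u γ σ) * B ρ u i σ
        = ∑ ρ, ∑ σ, g u ρ σ * ∑ γ, Γ α u γ ρ * B γ u i σ := by
      simp only [Finset.mul_sum, Finset.sum_mul]
      refine Finset.sum_comm_cycle.trans <| Finset.sum_congr rfl fun γ _ ↦ ?_
      rw [Finset.sum_comm]
      exact Finset.sum_congr rfl fun σ _ ↦ Finset.sum_congr rfl fun ρ _ ↦ by ring
    simp only [matCovDeriv, Matrix.sub_apply, Matrix.add_apply, matDeriv_apply, mul_sub, mul_add,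
      sub_mul, neg_mul, Finset.sum_add_distrib, Finset.sum_sub_distrib,
      Finset.sum_neg_distrib] at h1 ⊢
    rw [h2]
    simp only [Matrix.mul_apply]
    linarith
  -- The covariant derivative of the symmetric tensor `∇df` is symmetric in the same two slots.
  have hBsym (ρ σ : Fin m) : matCovDeriv I A Γ ρ (B σ) u i α - ∑ γ, Γ ρ u γ σ * B γ u i α
      = matCovDeriv I A Γ ρ (B α) u i σ - ∑ γ, Γ ρ u γ α * B γ u i σ := by
    have hBφ : ∀ σ α j, B σ u j α = B α u j σ := hφs u hu
    have e1 : pderiv I ρ (fun v ↦ B σ v i α) u = pderiv I ρ (fun v ↦ B α v i σ) u :=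
      pderiv_congr hU hu (fun v hv ↦ hφs v hv σ α i) ρ
    have e2 : (A ρ u * B σ u) i α = (A ρ u * B α u) i σ := by
      simp only [Matrix.mul_apply]
      exact Finset.sum_congr rfl fun j _ ↦ by rw [hBφ σ α j]
    have e3 (σ α : Fin m) : (B σ u * Γ ρ u) i α = ∑ γ, Γ ρ u γ α * B γ u i σ := by
      simp only [Matrix.mul_apply]
      exact Finset.sum_congr rfl fun γ _ ↦ by rw [hBφ σ γ i, mul_comm]
    rw [matCovDeriv, matCovDeriv.eq_def I A Γ ρ (B α) u]
    simp only [Matrix.sub_apply, Matrix.add_apply, matDeriv_apply, e1, e2, e3]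
    ring
  -- Swap `σ` and `α`, then commute `∇_ρ` with `∇_α`. The remaining Christoffel corrections agree
  -- since `Γ` is torsion-free, and the non-curvature part is `h0`.
  calc _ = ∑ ρ, ∑ σ, (g u ρ σ * (curvMatrix I A ρ α u * φ u - φ u * curvMatrix I Γ ρ α u) i σ
        + g u ρ σ * (matCovDeriv I A Γ α (B ρ) u i σ - ∑ γ, Γ α u γ ρ * B γ u i σ)) := by
        refine Finset.sum_congr rfl fun ρ _ ↦ Finset.sum_congr rfl fun σ _ ↦ ?_
        rw [hBsym, matCovDeriv_comm hU hA hΓ hφ hu ρ α, Matrix.add_apply]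
        simp only [hΓs u hu ρ α]
        ring
    _ = _ := by simp only [Finset.sum_add_distrib, h0, add_zero]

/-- The Bochner formula for the energy density of a harmonic map, in coordinates. -/
theorem laplacian_trace_pairing (hU : RelOpen I U) (hA : ∀ α, MatSmooth I U (A α))
    (hΓ : ∀ α, MatSmooth I U (Γ α)) (hφ : MatSmooth I U φ) (hg : MatSmooth I U g)
    (hh : MatSmooth I U h) (hgs : ∀ v ∈ U, (g v)ᵀ = g v) (hhs : ∀ v ∈ U, (h v)ᵀ = h v)
    (hAh : ∀ α, ∀ v ∈ U, matDeriv I α h v = (A α v)ᵀ * h v + h v * A α v)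
    (hΓg : ∀ α, ∀ v ∈ U, matDeriv I α g v = -(g v * (Γ α v)ᵀ) - Γ α v * g v)
    (hΓs : ∀ v ∈ U, ∀ α β γ, Γ α v γ β = Γ β v γ α)
    (hφs : ∀ v ∈ U, ∀ α β i, matCovDeriv I A Γ α φ v i β = matCovDeriv I A Γ β φ v i α)
    (hharm : ∀ v ∈ U, ∀ i, ∑ α, ∑ β, g v α β * matCovDeriv I A Γ α φ v i β = 0)
    (hu : u ∈ U) {E : EuclideanSpace ℝ (Fin m) → ℝ}
    (hE : ∀ v ∈ U, E v = 1 / 2 * ((φ v)ᵀ * h v * φ v * g v).trace) :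
    ∑ ρ, ∑ σ, g u ρ σ * (pderiv I ρ (pderiv I σ E) u - ∑ γ, Γ ρ u γ σ * pderiv I γ E u)
      = ∑ ρ, ∑ σ, g u ρ σ *
          ((matCovDeriv I A Γ σ φ u)ᵀ * h u * matCovDeriv I A Γ ρ φ u * g u).trace
        + ∑ i, ∑ α, (∑ ρ, ∑ σ, g u ρ σ *
          (curvMatrix I A ρ α u * φ u - φ u * curvMatrix I Γ ρ α u) i σ) *
            (h u * φ u * g u) i α := by
  set B := fun α ↦ matCovDeriv I A Γ α φ with hB
  have hBs : ∀ α, MatSmooth I U (B α) := fun α ↦ hφ.matCovDeriv hU hA hΓ α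
  have hEs : SmoothIn I U (fun v ↦ ((φ v)ᵀ * h v * φ v * g v).trace) :=
    (((hφ.transpose.mul hh).mul hφ).mul hg).trace
  -- The two Leibniz terms coincide by symmetry of the pairing, which absorbs the factor `1/2`. The
  -- identity is needed on all of `U`, since it is differentiated again.
  have hd1 (σ) : ∀ v ∈ U, pderiv I σ E v = ((B σ v)ᵀ * h v * φ v * g v).trace := fun v hv ↦ by
    rw [pderiv_congr hU hv hE, pderiv_const_mul hU hEs hv,
      pderiv_trace_pairing hU hφ hφ hh hg hv σ (hAh σ v hv) (hΓg σ v hv),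
      trace_pairing_comm (hhs v hv) (hgs v hv) (φ v)]
    ring
  have hd2 (ρ σ) : pderiv I ρ (pderiv I σ E) u
      = (((matCovDeriv I A Γ ρ (B σ) u)ᵀ * h u * φ u * g u).trace)
        + ((B σ u)ᵀ * h u * B ρ u * g u).trace := by
    rw [pderiv_congr hU hu (hd1 σ),
      pderiv_trace_pairing hU (hBs σ) hφ hh hg hu ρ (hAh ρ u hu) (hΓg ρ u hu)]
  have htr (X : Matrix a (Fin m) ℝ) := trace_transpose_mul_mul_mul X (h u) (φ u) (g u)
  -- The curvature term is traded back for the divergence of `∇df`; the identity then holds for each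
  -- pair `ρ, σ` separately.
  simp only [← div_matCovDeriv hU hA hΓ hφ hg hΓg hΓs hφs hharm hu]
  simp only [hd2, hd1 _ u hu, htr (matCovDeriv I A Γ _ (B _) u), htr (B _ u)]
  have hswap (T : Fin m → Fin m → a → Fin m → ℝ) (w : Matrix a (Fin m) ℝ) :
      ∑ i, ∑ α, (∑ ρ, ∑ σ, T ρ σ i α) * w i α = ∑ ρ, ∑ σ, ∑ i, ∑ α, T ρ σ i α * w i α := by
    simp only [Finset.sum_mul]
    calc _ = ∑ i, ∑ ρ, ∑ α, ∑ σ, T ρ σ i α * w i α :=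
          Finset.sum_congr rfl fun i _ ↦ Finset.sum_comm
      _ = ∑ ρ, ∑ i, ∑ σ, ∑ α, T ρ σ i α * w i α := by
          rw [Finset.sum_comm]
          exact Finset.sum_congr rfl fun ρ _ ↦ Finset.sum_congr rfl fun i _ ↦ Finset.sum_comm
      _ = _ := Finset.sum_congr rfl fun ρ _ ↦ Finset.sum_comm
  rw [hswap]
  simp only [← Finset.sum_add_distrib]
  refine Finset.sum_congr rfl fun ρ _ ↦ Finset.sum_congr rfl fun σ _ ↦ ?_
  have h1 : ∑ γ, Γ ρ u γ σ * ∑ i, ∑ α, B γ u i α * (h u * φ u * g u) i α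
      = ∑ i, ∑ α, (∑ γ, Γ ρ u γ σ * B γ u i α) * (h u * φ u * g u) i α := by
    simp only [Finset.mul_sum, Finset.sum_mul]
    rw [Finset.sum_comm]
    refine Finset.sum_congr rfl fun i _ ↦ ?_
    rw [Finset.sum_comm]
    simp only [mul_assoc]
  rw [h1]
  simp only [mul_assoc, sub_mul, ← Finset.mul_sum, Finset.sum_sub_distrib]
  ring

end Bochner

/-! ## The metric and the Levi-Civita connection in a chart -/

section Chart

open Matrix Set Filter Topology

variable {m : ℕ} {H : Type*} [TopologicalSpace H]
  {I : ModelWithCorners ℝ (EuclideanSpace ℝ (Fin m)) H}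
  {M : Type*} [TopologicalSpace M] [ChartedSpace H M]

theorem relOpen_target (x₀ : M) : RelOpen I (extChartAt I x₀).target where
  subset := extChartAt_target_subset_range x₀
  mem_nhdsWithin _ hu := extChartAt_target_mem_nhdsWithin_of_mem hu

theorem RelOpen.inter {U V : Set (EuclideanSpace ℝ (Fin m))} (hU : RelOpen I U)
    (hV : ∀ u ∈ U, u ∈ V → V ∈ 𝓝[range I] u) : RelOpen I (U ∩ V) where
  subset := inter_subset_left.trans hU.subset
  mem_nhdsWithin u hu := inter_mem (hU.mem_nhdsWithin u hu.1) (hV u hu.1 hu.2)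

section

variable [IsManifold I 1 M]

theorem mem_baseSet_iff (x₀ x : M) :
    x ∈ (trivializationAt (EuclideanSpace ℝ (Fin m)) (TangentSpace I) x₀).baseSet
      ↔ x ∈ (chartAt H x₀).source := by
  simp

theorem coordComp_coordVec {x₀ x : M} (hx : x ∈ (chartAt H x₀).source) (α β : Fin m) :
    coordComp I x₀ x (coordVec I x₀ x β) α = if α = β then 1 else 0 := by
  unfold coordComp coordVec
  rw [Trivialization.continuousLinearMapAt_symmL _ ((mem_baseSet_iff x₀ x).2 hx)]
  simp [PiLp.single_apply]

theorem sum_coordComp_smul_coordVec {x₀ x : M} (hx : x ∈ (chartAt H x₀).source)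
    (X : TangentSpace I x) : ∑ α, coordComp I x₀ x X α • coordVec I x₀ x α = X := by
  conv_rhs => rw [← Trivialization.symmL_continuousLinearMapAt (R := ℝ)
    (trivializationAt (EuclideanSpace ℝ (Fin m)) (TangentSpace I) x₀)
    ((mem_baseSet_iff x₀ x).2 hx) X]
  unfold coordComp coordVec
  simp only [← map_smul, ← map_sum]
  congr 1
  ext i
  simp [Pi.single_apply]

theorem coordComp_smul (x₀ x : M) (c : ℝ) (X : TangentSpace I x) (α : Fin m) :
    coordComp I x₀ x (c • X) α = c * coordComp I x₀ x X α := by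
  simp [coordComp]

theorem coordComp_sum {ι : Type*} (s : Finset ι) (x₀ x : M) (X : ι → TangentSpace I x)
    (α : Fin m) : coordComp I x₀ x (∑ i ∈ s, X i) α = ∑ i ∈ s, coordComp I x₀ x (X i) α := by
  simp [coordComp]

variable [RiemannianBundle (fun x : M ↦ TangentSpace I x)]

theorem metricMatrix_apply {x₀ x : M} (hx : x ∈ (chartAt H x₀).source) (α β : Fin m) :
    metricMatrix I x₀ (extChartAt I x₀ x) α β
      = inner ℝ (coordVec I x₀ x α) (coordVec I x₀ x β) := by
  have : (extChartAt I x₀).symm (extChartAt I x₀ x) = x :=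
    (extChartAt I x₀).left_inv (by simpa using hx)
  simp only [metricMatrix, Matrix.of_apply]
  rw [this]

theorem metricMatrix_transpose (x₀ : M) (u : EuclideanSpace ℝ (Fin m)) :
    (metricMatrix I x₀ u)ᵀ = metricMatrix I x₀ u := by
  ext α β
  exact real_inner_comm (coordVec I x₀ ((extChartAt I x₀).symm u) α)
    (coordVec I x₀ ((extChartAt I x₀).symm u) β)

theorem invMetricMatrix_transpose (x₀ : M) (u : EuclideanSpace ℝ (Fin m)) :
    (invMetricMatrix I x₀ u)ᵀ = invMetricMatrix I x₀ u := by
  rw [invMetricMatrix, Matrix.transpose_nonsing_inv, metricMatrix_transpose]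

/-- Entry `(α, γ)` is the `α`-component of `∑ ⟨e_a, ∂_γ⟩ e_a`, which is the orthonormal expansion of
`∂_γ`. -/
theorem sum_coordComp_mul_coordComp_mul_metricMatrix {x₀ x : M} (hx : x ∈ (chartAt H x₀).source)
    {ι : Type*} [Fintype ι] (e : OrthonormalBasis ι ℝ (TangentSpace I x)) :
    (Matrix.of fun α β ↦ ∑ a, coordComp I x₀ x (e a) α * coordComp I x₀ x (e a) β)
      * metricMatrix I x₀ (extChartAt I x₀ x) = 1 := by
  ext α γ
  have h1 (a : ι) : ∑ β, coordComp I x₀ x (e a) β * metricMatrix I x₀ (extChartAt I x₀ x) β γ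
      = inner ℝ (e a) (coordVec I x₀ x γ) := by
    conv_rhs => rw [← sum_coordComp_smul_coordVec hx (e a)]
    simp only [sum_inner, inner_smul_left, metricMatrix_apply hx]
    rfl
  have h2 : ∑ a, inner ℝ (e a) (coordVec I x₀ x γ) • e a = coordVec I x₀ x γ := e.sum_repr' _
  calc _ = ∑ a, coordComp I x₀ x (e a) α * inner ℝ (e a) (coordVec I x₀ x γ) := by
        simp only [Matrix.mul_apply, Matrix.of_apply, Finset.sum_mul]
        rw [Finset.sum_comm]
        simp only [← h1, Finset.mul_sum, mul_assoc]
    _ = coordComp I x₀ x (∑ a, inner ℝ (e a) (coordVec I x₀ x γ) • e a) α := by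
        rw [coordComp_sum]
        simp only [coordComp_smul, mul_comm]
    _ = _ := by rw [h2, coordComp_coordVec hx, Matrix.one_apply]

/-- The inverse metric is `∑ e_a ⊗ e_a` for any orthonormal basis `(e_a)`. -/
theorem sum_coordComp_mul_coordComp {x₀ x : M} (hx : x ∈ (chartAt H x₀).source)
    {ι : Type*} [Fintype ι] (e : OrthonormalBasis ι ℝ (TangentSpace I x)) (α β : Fin m) :
    ∑ a, coordComp I x₀ x (e a) α * coordComp I x₀ x (e a) β
      = invMetricMatrix I x₀ (extChartAt I x₀ x) α β := by
  rw [invMetricMatrix, Matrix.inv_eq_left_inv (sum_coordComp_mul_coordComp_mul_metricMatrix hx e)]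
  rfl

/-- The matrix is a Gram matrix, so its determinant is nonnegative; the left inverse built from an
orthonormal basis excludes zero. -/
theorem metricMatrix_det_pos {x₀ : M} {u : EuclideanSpace ℝ (Fin m)}
    (hu : u ∈ (extChartAt I x₀).target) : 0 < (metricMatrix I x₀ u).det := by
  set x := (extChartAt I x₀).symm u with hx
  have hxs : x ∈ (chartAt H x₀).source := by
    simpa only [extChartAt_source] using (extChartAt I x₀).map_target hu
  have hux : extChartAt I x₀ x = u := (extChartAt I x₀).right_inv hu
  have : FiniteDimensional ℝ (TangentSpace I x) :=
    inferInstanceAs (FiniteDimensional ℝ (EuclideanSpace ℝ (Fin m)))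
  have h1 := sum_coordComp_mul_coordComp_mul_metricMatrix hxs
    (stdOrthonormalBasis ℝ (TangentSpace I x))
  rw [hux] at h1
  have h2 : (metricMatrix I x₀ u).det ≠ 0 := fun h0 ↦ by
    have := congrArg Matrix.det h1
    simp [h0] at this
  have h3 : metricMatrix I x₀ u = Matrix.gram ℝ (coordVec I x₀ x) := rfl
  exact lt_of_le_of_ne (h3 ▸ (Matrix.posSemidef_gram ℝ _).det_nonneg) h2.symm

variable {x₀ : M} {u : EuclideanSpace ℝ (Fin m)}

theorem metricMatrix_mul_invMetricMatrix (hu : u ∈ (extChartAt I x₀).target) :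
    metricMatrix I x₀ u * invMetricMatrix I x₀ u = 1 :=
  Matrix.mul_nonsing_inv _ (metricMatrix_det_pos hu).ne'.isUnit

theorem invMetricMatrix_mul_metricMatrix (hu : u ∈ (extChartAt I x₀).target) :
    invMetricMatrix I x₀ u * metricMatrix I x₀ u = 1 :=
  Matrix.nonsing_inv_mul _ (metricMatrix_det_pos hu).ne'.isUnit

theorem sqrtDet_pos (hu : u ∈ (extChartAt I x₀).target) : 0 < sqrtDet I x₀ u :=
  Real.sqrt_pos.2 (metricMatrix_det_pos hu)

variable (I x₀) in
/-- The matrix `(Γ_α)^γ_β = Γ^γ_{αβ}` of the Levi-Civita connection. -/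
def christoffelMatrix (α : Fin m) (u : EuclideanSpace ℝ (Fin m)) : Matrix (Fin m) (Fin m) ℝ :=
  Matrix.of fun γ β ↦ christoffel I x₀ γ α β u

theorem christoffel_symm (γ α β : Fin m) :
    christoffel I x₀ γ α β u = christoffel I x₀ γ β α u := by
  have : (fun v ↦ metricMatrix I x₀ v α β) = fun v ↦ metricMatrix I x₀ v β α :=
    funext fun v ↦ congrFun (congrFun (metricMatrix_transpose x₀ v) β) α
  unfold christoffel
  rw [this]
  simp only [add_comm]

theorem curvMatrix_christoffelMatrix (γ δ α β : Fin m) :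
    curvMatrix I (christoffelMatrix I x₀) α β u γ δ = curvatureCoeff I x₀ γ δ α β u := by
  simp only [curvMatrix, curvatureCoeff, Matrix.add_apply, Matrix.sub_apply, Matrix.mul_apply,
    matDeriv_apply, Finset.sum_sub_distrib]
  rfl

/-- The Levi-Civita connection is metric. -/
theorem matDeriv_metricMatrix (hu : u ∈ (extChartAt I x₀).target) (α : Fin m) :
    matDeriv I α (metricMatrix I x₀) u
      = (christoffelMatrix I x₀ α u)ᵀ * metricMatrix I x₀ u
        + metricMatrix I x₀ u * christoffelMatrix I x₀ α u := by
  -- `K` is twice the Christoffel symbol with its upper index lowered. In `K + Kᵀ` the terms other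
  -- than `∂_α g` cancel, leaving `2 ∂_α g`.
  set K : Matrix (Fin m) (Fin m) ℝ := Matrix.of fun δ β ↦
    (pderiv I α (fun v ↦ metricMatrix I x₀ v β δ) u
      + pderiv I β (fun v ↦ metricMatrix I x₀ v α δ) u
      - pderiv I δ (fun v ↦ metricMatrix I x₀ v α β) u) with hK
  have h1 : christoffelMatrix I x₀ α u = (1 / 2 : ℝ) • (invMetricMatrix I x₀ u * K) := by
    ext γ β
    simp [christoffelMatrix, christoffel, hK, Matrix.mul_apply]
  have h2 : metricMatrix I x₀ u * christoffelMatrix I x₀ α u = (1 / 2 : ℝ) • K := by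
    rw [h1, Matrix.mul_smul, ← Matrix.mul_assoc, metricMatrix_mul_invMetricMatrix hu,
      Matrix.one_mul]
  have h3 : (christoffelMatrix I x₀ α u)ᵀ * metricMatrix I x₀ u = (1 / 2 : ℝ) • Kᵀ := by
    rw [← Matrix.transpose_smul, ← h2, Matrix.transpose_mul, metricMatrix_transpose]
  rw [h2, h3]
  have hs (i j : Fin m) : (fun v ↦ metricMatrix I x₀ v i j) = fun v ↦ metricMatrix I x₀ v j i :=
    funext fun v ↦ congrFun (congrFun (metricMatrix_transpose x₀ v) j) i
  ext β δ
  simp only [hK, matDeriv_apply, Matrix.add_apply, Matrix.smul_apply, Matrix.transpose_apply,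
    Matrix.of_apply, smul_eq_mul, hs δ β]
  ring

end

/-! ### Smoothness of the metric data, and the divergence in covariant form. -/

variable [IsManifold I ∞ M]

theorem contMDiffOn_coordVec (x₀ : M) (α : Fin m) :
    ContMDiffOn I (I.prod 𝓘(ℝ, EuclideanSpace ℝ (Fin m))) ∞
      (fun x ↦ (⟨x, coordVec I x₀ x α⟩ : TangentBundle I M)) (chartAt H x₀).source := by
  set e := trivializationAt (EuclideanSpace ℝ (Fin m)) (TangentSpace I : M → Type _) x₀
  have h1 := e.contMDiffOn_localFrame_baseSet (I := I) ∞
    (EuclideanSpace.basisFun (Fin m) ℝ).toBasis α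
  have hb : e.baseSet = (chartAt H x₀).source := by
    ext x
    exact mem_baseSet_iff x₀ x
  rw [hb] at h1
  refine h1.congr fun x hx ↦ ?_
  rw [e.localFrame_apply_of_mem_baseSet _ ((mem_baseSet_iff x₀ x).2 hx)]
  simp only [coordVec, Trivialization.basisAt, Module.Basis.map_apply,
    Trivialization.symmL_apply _ ((mem_baseSet_iff x₀ x).2 hx)]
  simp [e]

variable [RiemannianBundle (fun x : M ↦ TangentSpace I x)]
  [IsContMDiffRiemannianBundle I ∞ (EuclideanSpace ℝ (Fin m)) (fun x : M ↦ TangentSpace I x)]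

theorem matSmooth_metricMatrix (x₀ : M) :
    MatSmooth I (extChartAt I x₀).target (metricMatrix I x₀) := fun α β u hu ↦ by
  have h1 : ContMDiffOn I 𝓘(ℝ, ℝ) ∞
      (fun x : M ↦ (inner ℝ (coordVec I x₀ x α) (coordVec I x₀ x β) : ℝ)) (chartAt H x₀).source :=
    ContMDiffOn.inner_bundle (F := EuclideanSpace ℝ (Fin m))
      (E := fun x : M ↦ TangentSpace I x) (b := id) (contMDiffOn_coordVec x₀ α)
      (contMDiffOn_coordVec x₀ β)
  have h2 := h1.comp (contMDiffOn_extChartAt_symm x₀) fun v hv ↦ by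
    rw [mem_preimage, ← extChartAt_source I]
    exact (extChartAt I x₀).map_target hv
  exact (contMDiffWithinAt_iff_contDiffWithinAt.1 (h2 u hu)).mono_of_mem_nhdsWithin
    ((relOpen_target x₀).mem_nhdsWithin u hu)

theorem matSmooth_invMetricMatrix (x₀ : M) :
    MatSmooth I (extChartAt I x₀).target (invMetricMatrix I x₀) :=
  (matSmooth_metricMatrix x₀).inv fun _ hv ↦ (metricMatrix_det_pos hv).ne'

variable {x₀ : M} {u : EuclideanSpace ℝ (Fin m)}

theorem matSmooth_christoffelMatrix (α : Fin m) :
    MatSmooth I (extChartAt I x₀).target (christoffelMatrix I x₀ α) := fun γ β ↦ by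
  have h (a i j : Fin m) := (matSmooth_metricMatrix (I := I) x₀ i j).pderiv (relOpen_target x₀) a
  exact (SmoothIn.const (1 / 2)).mul <| .sum fun δ _ ↦ (matSmooth_invMetricMatrix x₀ γ δ).mul <|
    ((h α β δ).add (h β α δ)).sub (h δ α β)

/-- Metric compatibility is inserted into `∂(g⁻¹) = -g⁻¹ (∂g) g⁻¹`; the result is the parallelism of
the inverse metric, as required by `pderiv_trace_pairing`. -/
theorem matDeriv_invMetricMatrix (hu : u ∈ (extChartAt I x₀).target) (α : Fin m) :
    matDeriv I α (invMetricMatrix I x₀) u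
      = -(invMetricMatrix I x₀ u * (christoffelMatrix I x₀ α u)ᵀ)
        - christoffelMatrix I x₀ α u * invMetricMatrix I x₀ u := by
  have h1 := matDeriv_inv (relOpen_target x₀) (matSmooth_metricMatrix (I := I) x₀)
    (fun _ hv ↦ (metricMatrix_det_pos hv).ne') hu α
  change matDeriv I α (fun v ↦ (metricMatrix I x₀ v)⁻¹) u = _
  rw [h1, matDeriv_metricMatrix hu]
  change -(invMetricMatrix I x₀ u * _ * invMetricMatrix I x₀ u) = _
  rw [Matrix.mul_add, Matrix.add_mul, ← Matrix.mul_assoc, ← Matrix.mul_assoc,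
    Matrix.mul_assoc _ _ (invMetricMatrix I x₀ u), metricMatrix_mul_invMetricMatrix hu,
    invMetricMatrix_mul_metricMatrix hu, Matrix.mul_one, Matrix.one_mul]
  abel

theorem smoothIn_sqrtDet : SmoothIn I (extChartAt I x₀).target (sqrtDet I x₀) :=
  (matSmooth_metricMatrix x₀).det.sqrt fun _ hv ↦ (metricMatrix_det_pos hv).ne'

/-- By Jacobi's formula the logarithmic derivative of `det g` is `tr(g⁻¹ ∂_α g)`, and metric
compatibility makes this `2 tr Γ_α`; the square root halves it. -/
theorem pderiv_sqrtDet (hu : u ∈ (extChartAt I x₀).target) (α : Fin m) :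
    pderiv I α (sqrtDet I x₀) u = sqrtDet I x₀ u * (christoffelMatrix I x₀ α u).trace := by
  have hg := matSmooth_metricMatrix (I := I) x₀
  have hd := metricMatrix_det_pos hu
  have h1 : pderiv I α (sqrtDet I x₀) u = _ :=
    pderiv_sqrt (relOpen_target x₀) hg.det (fun _ hv ↦ metricMatrix_det_pos hv) hu α
  have h2 : (metricMatrix I x₀ u).adjugate
      = (metricMatrix I x₀ u).det • invMetricMatrix I x₀ u := by
    rw [invMetricMatrix, Matrix.inv_def, Ring.inverse_eq_inv', smul_smul,
      mul_inv_cancel₀ hd.ne', one_smul]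
  have h3 : (invMetricMatrix I x₀ u * matDeriv I α (metricMatrix I x₀) u).trace
      = 2 * (christoffelMatrix I x₀ α u).trace := by
    rw [matDeriv_metricMatrix hu, Matrix.mul_add, Matrix.trace_add, ← Matrix.mul_assoc,
      Matrix.trace_mul_comm, ← Matrix.mul_assoc, ← Matrix.mul_assoc,
      metricMatrix_mul_invMetricMatrix hu, invMetricMatrix_mul_metricMatrix hu, Matrix.one_mul,
      Matrix.one_mul, Matrix.trace_transpose, two_mul]
  rw [h1, pderiv_det (relOpen_target x₀) hg hu, h2, Matrix.smul_mul, Matrix.trace_smul, h3]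
  have h4 : sqrtDet I x₀ u * sqrtDet I x₀ u = (metricMatrix I x₀ u).det :=
    Real.mul_self_sqrt hd.le
  have h5 := sqrtDet_pos hu
  change (2 * sqrtDet I x₀ u)⁻¹ * _ = _
  rw [← h4, smul_eq_mul]
  field_simp

/-- The divergence of a covector field in terms of its covariant derivative. -/
theorem divCoord_eq {U : Set (EuclideanSpace ℝ (Fin m))} (hU : RelOpen I U)
    (hUt : U ⊆ (extChartAt I x₀).target) {V : EuclideanSpace ℝ (Fin m) → Fin m → ℝ}
    (hV : ∀ τ, SmoothIn I U (fun v ↦ V v τ)) (hu : u ∈ U) :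
    divCoord I x₀ V u = ∑ σ, ∑ τ, invMetricMatrix I x₀ u σ τ *
      (pderiv I σ (fun v ↦ V v τ) u - ∑ γ, christoffelMatrix I x₀ σ u γ τ * V u γ) := by
  have hs : SmoothIn I U (sqrtDet I x₀) := fun v hv ↦ smoothIn_sqrtDet v (hUt hv)
  have hg : MatSmooth I U (invMetricMatrix I x₀) :=
    fun i j v hv ↦ matSmooth_invMetricMatrix x₀ i j v (hUt hv)
  have h5 := sqrtDet_pos (hUt hu)
  have hg' (α ρ σ) : pderiv I α (fun v ↦ invMetricMatrix I x₀ v ρ σ) u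
      = -(∑ γ, invMetricMatrix I x₀ u ρ γ * christoffelMatrix I x₀ α u σ γ)
        - ∑ γ, christoffelMatrix I x₀ α u ρ γ * invMetricMatrix I x₀ u γ σ := by
    have := congrFun (congrFun (matDeriv_invMetricMatrix (hUt hu) α) ρ) σ
    simpa [matDeriv_apply, Matrix.mul_apply] using this
  unfold divCoord
  simp only [pderiv_mul hU hs (.sum fun τ _ ↦ (hg _ τ).mul (hV τ)) hu, pderiv_sqrtDet (hUt hu),
    pderiv_sum hU (fun τ _ ↦ (hg _ τ).mul (hV τ)) hu, pderiv_mul hU (hg _ _) (hV _) hu, hg']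
  -- By symmetry of the lower indices, the term from `∂√g` cancels the half of `∂_σ g^{στ}` that
  -- contains `Γ^σ_{σγ}`. The other half (`hB`) becomes the correction `g^{στ} Γ^γ_{στ} V_γ`.
  have hA : ∑ σ, (christoffelMatrix I x₀ σ u).trace * ∑ τ, invMetricMatrix I x₀ u σ τ * V u τ
      = ∑ σ, ∑ τ, (∑ γ, christoffelMatrix I x₀ σ u σ γ * invMetricMatrix I x₀ u γ τ) * V u τ := by
    have hsymm (σ γ : Fin m) : christoffelMatrix I x₀ σ u σ γ = christoffelMatrix I x₀ γ u σ σ :=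
      christoffel_symm σ σ γ
    simp only [Finset.sum_mul, Finset.mul_sum, Matrix.trace, Matrix.diag_apply]
    refine Eq.trans ?_ Finset.sum_comm_cycle.symm
    refine Finset.sum_congr rfl fun γ _ ↦ ?_
    rw [Finset.sum_comm]
    exact Finset.sum_congr rfl fun σ _ ↦ Finset.sum_congr rfl fun τ _ ↦ by
      rw [hsymm]
      ring
  have hB : ∑ σ, ∑ τ, (∑ γ, invMetricMatrix I x₀ u σ γ * christoffelMatrix I x₀ σ u τ γ) * V u τ
      = ∑ σ, ∑ τ, invMetricMatrix I x₀ u σ τ * ∑ γ, christoffelMatrix I x₀ σ u γ τ * V u γ := by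
    refine Finset.sum_congr rfl fun σ _ ↦ ?_
    simp only [Finset.sum_mul, Finset.mul_sum]
    rw [Finset.sum_comm]
    exact Finset.sum_congr rfl fun σ _ ↦ Finset.sum_congr rfl fun γ _ ↦ by ring
  simp only [mul_assoc (sqrtDet I x₀ u), ← mul_add, ← Finset.mul_sum]
  rw [inv_mul_cancel_left₀ h5.ne']
  simp only [sub_mul, neg_mul, mul_sub, Finset.sum_add_distrib, Finset.sum_sub_distrib,
    Finset.sum_neg_distrib]
  rw [hA, hB]
  ring

end Chart

/-! ## The local expression of a smooth map -/

section Maps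

open Matrix Set Filter Topology

variable {m n : ℕ} {H : Type*} [TopologicalSpace H]
  {I : ModelWithCorners ℝ (EuclideanSpace ℝ (Fin m)) H}
  {M : Type*} [TopologicalSpace M] [ChartedSpace H M]
  {N : Type*} [TopologicalSpace N] [ChartedSpace (EuclideanSpace ℝ (Fin n)) N]

variable (I) in
/-- The part of the chart at `x₀` that is mapped into the chart at `y₀`. -/
def mapDomain {H' : Type*} [TopologicalSpace H']
    (J : ModelWithCorners ℝ (EuclideanSpace ℝ (Fin n)) H') {N : Type*} [TopologicalSpace N]
    [ChartedSpace H' N] (f : M → N) (x₀ : M) (y₀ : N) : Set (EuclideanSpace ℝ (Fin m)) :=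
  (extChartAt I x₀).target ∩
    {u | f ((extChartAt I x₀).symm u) ∈ (extChartAt J y₀).source}

variable (I) in
/-- The local expression of `f` in the charts at `x₀` and `y₀`. -/
def localExpr {H' : Type*} [TopologicalSpace H']
    (J : ModelWithCorners ℝ (EuclideanSpace ℝ (Fin n)) H') {N : Type*} [TopologicalSpace N]
    [ChartedSpace H' N] (f : M → N) (x₀ : M) (y₀ : N) (u : EuclideanSpace ℝ (Fin m)) :
    EuclideanSpace ℝ (Fin n) :=
  extChartAt J y₀ (f ((extChartAt I x₀).symm u))

variable {f : M → N} {x₀ : M} {y₀ : N} {u : EuclideanSpace ℝ (Fin m)}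

theorem mem_mapDomain {x : M} (hx : x ∈ (chartAt H x₀).source)
    (hy : f x ∈ (chartAt (EuclideanSpace ℝ (Fin n)) y₀).source) :
    extChartAt I x₀ x ∈ mapDomain I (𝓡 n) f x₀ y₀ := by
  have hx' : x ∈ (extChartAt I x₀).source := by rwa [extChartAt_source]
  refine ⟨(extChartAt I x₀).map_source hx', ?_⟩
  rwa [mem_ofPred_eq, (extChartAt I x₀).left_inv hx', extChartAt_source]

theorem localExpr_mem_target (hu : u ∈ mapDomain I (𝓡 n) f x₀ y₀) :
    localExpr I (𝓡 n) f x₀ y₀ u ∈ (extChartAt (𝓡 n) y₀).target :=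
  (extChartAt (𝓡 n) y₀).map_source hu.2

variable [IsManifold I ∞ M]

theorem contMDiffWithinAt_comp_extChartAt_symm (hf : ContMDiff I (𝓡 n) ∞ f)
    (hu : u ∈ (extChartAt I x₀).target) :
    ContMDiffWithinAt 𝓘(ℝ, EuclideanSpace ℝ (Fin m)) (𝓡 n) ∞
      (fun v ↦ f ((extChartAt I x₀).symm v)) (range I) u :=
  (hf.contMDiffAt.comp_contMDiffWithinAt u
    (contMDiffOn_extChartAt_symm x₀ u hu)).mono_of_mem_nhdsWithin
    ((relOpen_target x₀).mem_nhdsWithin u hu)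

/-- Continuity of `f` in the chart makes the preimage of the open chart domain in `N` a relative
neighbourhood. -/
theorem relOpen_mapDomain (hf : ContMDiff I (𝓡 n) ∞ f) : RelOpen I (mapDomain I (𝓡 n) f x₀ y₀) :=
  (relOpen_target x₀).inter fun _ hu hu' ↦
    (contMDiffWithinAt_comp_extChartAt_symm hf hu).continuousWithinAt.preimage_mem_nhdsWithin
      ((isOpen_extChartAt_source y₀).mem_nhds hu')

variable [IsManifold (𝓡 n) ∞ N]

theorem contDiffWithinAt_localExpr (hf : ContMDiff I (𝓡 n) ∞ f) (hu : u ∈ mapDomain I (𝓡 n) f x₀ y₀) :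
    ContDiffWithinAt ℝ ∞ (localExpr I (𝓡 n) f x₀ y₀) (range I) u :=
  contMDiffWithinAt_iff_contDiffWithinAt.1 <|
    (contMDiffAt_extChartAt' (by simpa using hu.2)).comp_contMDiffWithinAt u
      (contMDiffWithinAt_comp_extChartAt_symm hf hu.1)

theorem smoothIn_mapCoord (hf : ContMDiff I (𝓡 n) ∞ f) (i : Fin n) :
    SmoothIn I (mapDomain I (𝓡 n) f x₀ y₀) (mapCoord I (𝓡 n) f x₀ y₀ i) := fun _ hu ↦
  (contDiffWithinAt_euclidean.1 (contDiffWithinAt_localExpr hf hu)) i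

theorem pderiv_mapCoord (hf : ContMDiff I (𝓡 n) ∞ f) (hu : u ∈ mapDomain I (𝓡 n) f x₀ y₀) (i : Fin n)
    (α : Fin m) : pderiv I α (mapCoord I (𝓡 n) f x₀ y₀ i) u
      = fderivWithin ℝ (localExpr I (𝓡 n) f x₀ y₀) (range I) u (EuclideanSpace.single α 1) i := by
  have h1 := ((contDiffWithinAt_localExpr hf hu).differentiableWithinAt
    (by simp)).hasFDerivWithinAt
  have h2 := 
    (EuclideanSpace.proj i : EuclideanSpace ℝ (Fin n) →L[ℝ] ℝ).hasFDerivAt.comp_hasFDerivWithinAt u h1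
  exact congrArg (fun L ↦ L (EuclideanSpace.single α (1 : ℝ)))
    (h2.fderivWithin (I.uniqueDiffOn u ((relOpen_mapDomain hf).subset hu)))

theorem SmoothIn.comp_localExpr (hf : ContMDiff I (𝓡 n) ∞ f)
    {q : EuclideanSpace ℝ (Fin n) → ℝ} (hq : SmoothIn (𝓡 n) (extChartAt (𝓡 n) y₀).target q) :
    SmoothIn I (mapDomain I (𝓡 n) f x₀ y₀) (fun v ↦ q (localExpr I (𝓡 n) f x₀ y₀ v)) := fun u hu ↦
  (hq _ (localExpr_mem_target hu)).comp u (contDiffWithinAt_localExpr hf hu) fun _ _ ↦ by simp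

/-- The chain rule for functions on the target. -/
theorem pderiv_comp_localExpr (hf : ContMDiff I (𝓡 n) ∞ f)
    {q : EuclideanSpace ℝ (Fin n) → ℝ} (hq : SmoothIn (𝓡 n) (extChartAt (𝓡 n) y₀).target q)
    (hu : u ∈ mapDomain I (𝓡 n) f x₀ y₀) (α : Fin m) :
    pderiv I α (fun v ↦ q (localExpr I (𝓡 n) f x₀ y₀ v)) u
      = ∑ l, pderiv (𝓡 n) l q (localExpr I (𝓡 n) f x₀ y₀ u)
          * pderiv I α (mapCoord I (𝓡 n) f x₀ y₀ l) u := by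
  have hd := hq.differentiableWithinAt (localExpr_mem_target hu)
  simp only [pderiv_mapCoord hf hu]
  simp only [pderiv] at hd ⊢
  have h1 := fderivWithin_comp u hd
    ((contDiffWithinAt_localExpr hf hu).differentiableWithinAt (by simp))
    (fun _ _ ↦ by simp) (I.uniqueDiffOn u ((relOpen_mapDomain hf).subset hu))
  change fderivWithin ℝ (q ∘ localExpr I (𝓡 n) f x₀ y₀) (range I) u _ = _
  rw [h1, ContinuousLinearMap.comp_apply]
  set w := fderivWithin ℝ (localExpr I (𝓡 n) f x₀ y₀) (range I) u (EuclideanSpace.single α 1)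
  conv_lhs => rw [← (EuclideanSpace.basisFun (Fin n) ℝ).sum_repr w]
  simp [mul_comm]

/-- The differential in coordinates. -/
theorem coordComp_mfderiv_coordVec (hf : ContMDiff I (𝓡 n) ∞ f) {x : M}
    (hx : x ∈ (chartAt H x₀).source)
    (hy : f x ∈ (chartAt (EuclideanSpace ℝ (Fin n)) y₀).source) (k : Fin n) (α : Fin m) :
    coordComp (𝓡 n) y₀ (f x) (mfderiv I (𝓡 n) f x (coordVec I x₀ x α)) k
      = pderiv I α (mapCoord I (𝓡 n) f x₀ y₀ k) (extChartAt I x₀ x) := by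
  have hx' : x ∈ (extChartAt I x₀).source := by rwa [extChartAt_source]
  have hu := mem_mapDomain (I := I) (f := f) hx hy
  rw [pderiv_mapCoord hf hu, coordComp, coordVec,
    TangentBundle.continuousLinearMapAt_trivializationAt hy,
    TangentBundle.symmL_trivializationAt hx]
  set u := extChartAt I x₀ x with hu_def
  have hxu : (extChartAt I x₀).symm u = x := (extChartAt I x₀).left_inv hx'
  have h1 : HasMFDerivWithinAt 𝓘(ℝ, EuclideanSpace ℝ (Fin m)) I (extChartAt I x₀).symm (range I) u
      (mfderivWithin 𝓘(ℝ, EuclideanSpace ℝ (Fin m)) I (extChartAt I x₀).symm (range I) u) :=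
    (mdifferentiableWithinAt_extChartAt_symm hu.1).hasMFDerivWithinAt
  have h2 : HasMFDerivAt I (𝓡 n) f ((extChartAt I x₀).symm u) (mfderiv I (𝓡 n) f x) := by
    rw [hxu]
    exact (hf.mdifferentiable (by simp) _).hasMFDerivAt
  have h3 : HasMFDerivAt (𝓡 n) 𝓘(ℝ, EuclideanSpace ℝ (Fin n)) (extChartAt (𝓡 n) y₀)
      (f ((extChartAt I x₀).symm u))
      (mfderiv (𝓡 n) 𝓘(ℝ, EuclideanSpace ℝ (Fin n)) (extChartAt (𝓡 n) y₀) (f x)) := by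
    rw [hxu]
    exact (mdifferentiableAt_extChartAt hy).hasMFDerivAt
  -- Coordinate vectors and components are given by the derivatives of the inverse chart at `x₀` and
  -- of the chart at `y₀`, so the chain rule yields the derivative of the local expression.
  have h4 := (h3.comp_hasMFDerivWithinAt u (h2.comp_hasMFDerivWithinAt u h1)).mfderivWithin
    (I.uniqueDiffOn u ((relOpen_mapDomain hf).subset hu)).uniqueMDiffWithinAt
  rw [mfderivWithin_eq_fderivWithin] at h4
  exact (congrArg (fun L : EuclideanSpace ℝ (Fin m) →L[ℝ] EuclideanSpace ℝ (Fin n) ↦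
    L (EuclideanSpace.single α (1 : ℝ)) k) h4).symm

end Maps

/-! ## The pullback connection in coordinates -/

section Pullback

open Matrix Set Filter Topology

variable {m n : ℕ} {H : Type*} [TopologicalSpace H]
  {I : ModelWithCorners ℝ (EuclideanSpace ℝ (Fin m)) H}
  {M : Type*} [TopologicalSpace M] [ChartedSpace H M]
  {N : Type*} [TopologicalSpace N] [ChartedSpace (EuclideanSpace ℝ (Fin n)) N]

variable (I) in
/-- The matrix `∂_β f^i` of the differential. -/
def dfMatrix {H' : Type*} [TopologicalSpace H']
    (J : ModelWithCorners ℝ (EuclideanSpace ℝ (Fin n)) H') {N : Type*} [TopologicalSpace N]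
    [ChartedSpace H' N] (f : M → N) (x₀ : M) (y₀ : N) (u : EuclideanSpace ℝ (Fin m)) :
    Matrix (Fin n) (Fin m) ℝ :=
  Matrix.of fun i β ↦ pderiv I β (mapCoord I J f x₀ y₀ i) u

variable (I) in
/-- The matrices `Γ^k_{ij}(f) ∂_α f^i` of the pullback connection. -/
def pullbackMatrix {H' : Type*} [TopologicalSpace H']
    (J : ModelWithCorners ℝ (EuclideanSpace ℝ (Fin n)) H') {N : Type*} [TopologicalSpace N]
    [ChartedSpace H' N] [IsManifold J 1 N] [RiemannianBundle (fun y : N ↦ TangentSpace J y)]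
    (f : M → N) (x₀ : M) (y₀ : N) (α : Fin m) (u : EuclideanSpace ℝ (Fin m)) :
    Matrix (Fin n) (Fin n) ℝ :=
  Matrix.of fun k j ↦ ∑ i, christoffelMatrix J y₀ i (localExpr I J f x₀ y₀ u) k j *
    dfMatrix I J f x₀ y₀ u i α

variable {f : M → N} {x₀ : M} {y₀ : N} {u : EuclideanSpace ℝ (Fin m)}

variable [IsManifold I ∞ M] [IsManifold (𝓡 n) ∞ N]

theorem matSmooth_dfMatrix (hf : ContMDiff I (𝓡 n) ∞ f) :
    MatSmooth I (mapDomain I (𝓡 n) f x₀ y₀) (dfMatrix I (𝓡 n) f x₀ y₀) :=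
  fun i β ↦ (smoothIn_mapCoord hf i).pderiv (relOpen_mapDomain hf) β

theorem pderiv_dfMatrix_symm (hf : ContMDiff I (𝓡 n) ∞ f) (hu : u ∈ mapDomain I (𝓡 n) f x₀ y₀)
    (i : Fin n) (α β : Fin m) :
    pderiv I α (fun v ↦ dfMatrix I (𝓡 n) f x₀ y₀ v i β) u
      = pderiv I β (fun v ↦ dfMatrix I (𝓡 n) f x₀ y₀ v i α) u :=
  pderiv_comm (relOpen_mapDomain hf) (smoothIn_mapCoord hf i) hu α β

variable [RiemannianBundle (fun y : N ↦ TangentSpace (𝓡 n) y)]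

theorem matCovDeriv_dfMatrix [RiemannianBundle (fun x : M ↦ TangentSpace I x)] (k : Fin n)
    (α β : Fin m) :
    matCovDeriv I (pullbackMatrix I (𝓡 n) f x₀ y₀) (christoffelMatrix I x₀) α
      (dfMatrix I (𝓡 n) f x₀ y₀) u k β = nablaDfCoeff I (𝓡 n) f x₀ y₀ k α β u := by
  have h1 : (pullbackMatrix I (𝓡 n) f x₀ y₀ α u * dfMatrix I (𝓡 n) f x₀ y₀ u) k β
      = ∑ i, ∑ j, christoffel (𝓡 n) y₀ k i j (extChartAt (𝓡 n) y₀ (f ((extChartAt I x₀).symm u))) *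
        pderiv I α (mapCoord I (𝓡 n) f x₀ y₀ i) u * pderiv I β (mapCoord I (𝓡 n) f x₀ y₀ j) u := by
    simp only [Matrix.mul_apply, pullbackMatrix, Matrix.of_apply, Finset.sum_mul]
    rw [Finset.sum_comm]
    rfl
  have h2 : (dfMatrix I (𝓡 n) f x₀ y₀ u * christoffelMatrix I x₀ α u) k β
      = ∑ γ, christoffel I x₀ γ α β u * pderiv I γ (mapCoord I (𝓡 n) f x₀ y₀ k) u := by
    rw [Matrix.mul_apply]
    exact Finset.sum_congr rfl fun γ _ ↦ mul_comm _ _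
  simp only [matCovDeriv, nablaDfCoeff, Matrix.sub_apply, Matrix.add_apply, h1, h2]
  rw [sub_add_eq_add_sub]
  rfl

/-- Partial derivatives of `f` commute, and both sets of Christoffel symbols are symmetric in their
lower indices. -/
theorem matCovDeriv_dfMatrix_symm [RiemannianBundle (fun x : M ↦ TangentSpace I x)]
    (hf : ContMDiff I (𝓡 n) ∞ f) (hu : u ∈ mapDomain I (𝓡 n) f x₀ y₀) (k : Fin n) (α β : Fin m) :
    matCovDeriv I (pullbackMatrix I (𝓡 n) f x₀ y₀) (christoffelMatrix I x₀) α
        (dfMatrix I (𝓡 n) f x₀ y₀) u k β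
      = matCovDeriv I (pullbackMatrix I (𝓡 n) f x₀ y₀) (christoffelMatrix I x₀) β
        (dfMatrix I (𝓡 n) f x₀ y₀) u k α := by
  have h1 : (dfMatrix I (𝓡 n) f x₀ y₀ u * christoffelMatrix I x₀ α u) k β
      = (dfMatrix I (𝓡 n) f x₀ y₀ u * christoffelMatrix I x₀ β u) k α := by
    simp only [Matrix.mul_apply]
    exact Finset.sum_congr rfl fun γ _ ↦ congrArg _ (christoffel_symm γ α β)
  have h2 : (pullbackMatrix I (𝓡 n) f x₀ y₀ α u * dfMatrix I (𝓡 n) f x₀ y₀ u) k β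
      = (pullbackMatrix I (𝓡 n) f x₀ y₀ β u * dfMatrix I (𝓡 n) f x₀ y₀ u) k α := by
    simp only [Matrix.mul_apply, pullbackMatrix, Matrix.of_apply, Finset.sum_mul]
    rw [Finset.sum_comm]
    refine Finset.sum_congr rfl fun i _ ↦ Finset.sum_congr rfl fun j _ ↦ ?_
    have : christoffelMatrix (𝓡 n) y₀ i (localExpr I (𝓡 n) f x₀ y₀ u) k j
      = christoffelMatrix (𝓡 n) y₀ j (localExpr I (𝓡 n) f x₀ y₀ u) k i := christoffel_symm k i j
    rw [this]
    ring
  simp only [matCovDeriv, Matrix.sub_apply, Matrix.add_apply, matDeriv_apply, h1, h2,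
    pderiv_dfMatrix_symm hf hu k α β]

/-- The tension field of a harmonic map vanishes. -/
theorem IsHarmonicMap.sum_matCovDeriv_eq_zero [RiemannianBundle (fun x : M ↦ TangentSpace I x)]
    [IsContMDiffRiemannianBundle I ∞ (EuclideanSpace ℝ (Fin m)) (fun x : M ↦ TangentSpace I x)]
    (hf : IsHarmonicMap I (𝓡 n) f) (hu : u ∈ mapDomain I (𝓡 n) f x₀ y₀) (k : Fin n) :
    ∑ α, ∑ β, invMetricMatrix I x₀ u α β *
      matCovDeriv I (pullbackMatrix I (𝓡 n) f x₀ y₀) (christoffelMatrix I x₀) α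
        (dfMatrix I (𝓡 n) f x₀ y₀) u k β = 0 := by
  have hU := relOpen_mapDomain (x₀ := x₀) (y₀ := y₀) hf.contMDiff
  have h1 := hf.codifferential_eq_zero x₀ y₀ ((extChartAt I x₀).symm u)
    (by simpa only [extChartAt_source] using (extChartAt I x₀).map_target hu.1)
    (by rw [← extChartAt_source (𝓡 n)]; exact hu.2) k
  rw [(extChartAt I x₀).right_inv hu.1, codifferential, neg_eq_zero,
    divCoord_eq (V := fun v β ↦ pderiv I β (mapCoord I (𝓡 n) f x₀ y₀ k) v) hU inter_subset_left
      (fun τ ↦ matSmooth_dfMatrix hf.contMDiff k τ) hu,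
    ← Finset.sum_add_distrib] at h1
  rw [← h1]
  refine Finset.sum_congr rfl fun α _ ↦ ?_
  rw [← Finset.sum_add_distrib]
  refine Finset.sum_congr rfl fun β _ ↦ ?_
  rw [matCovDeriv_dfMatrix, nablaDfCoeff, mul_add]
  congr 1
  simp only [Finset.mul_sum, mul_assoc]

variable [IsContMDiffRiemannianBundle (𝓡 n) ∞ (EuclideanSpace ℝ (Fin n))
  (fun y : N ↦ TangentSpace (𝓡 n) y)]

theorem matSmooth_christoffel_comp (hf : ContMDiff I (𝓡 n) ∞ f) (i : Fin n) :
    MatSmooth I (mapDomain I (𝓡 n) f x₀ y₀)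
      (fun v ↦ christoffelMatrix (𝓡 n) y₀ i (localExpr I (𝓡 n) f x₀ y₀ v)) :=
  fun k j ↦ (matSmooth_christoffelMatrix i k j).comp_localExpr hf

theorem matSmooth_pullbackMatrix (hf : ContMDiff I (𝓡 n) ∞ f) (α : Fin m) :
    MatSmooth I (mapDomain I (𝓡 n) f x₀ y₀) (pullbackMatrix I (𝓡 n) f x₀ y₀ α) :=
  fun k j ↦ SmoothIn.sum (s := Finset.univ) (F := fun i v ↦ christoffelMatrix (𝓡 n) y₀ i
    (localExpr I (𝓡 n) f x₀ y₀ v) k j * dfMatrix I (𝓡 n) f x₀ y₀ v i α) fun i _ ↦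
      (matSmooth_christoffel_comp hf i k j).mul (matSmooth_dfMatrix hf i α)

theorem matSmooth_metricMatrix_comp (hf : ContMDiff I (𝓡 n) ∞ f) :
    MatSmooth I (mapDomain I (𝓡 n) f x₀ y₀)
      (fun v ↦ metricMatrix (𝓡 n) y₀ (localExpr I (𝓡 n) f x₀ y₀ v)) :=
  fun i j ↦ (matSmooth_metricMatrix y₀ i j).comp_localExpr hf

/-- The pullback connection is metric. -/
theorem matDeriv_metricMatrix_comp (hf : ContMDiff I (𝓡 n) ∞ f)
    (hu : u ∈ mapDomain I (𝓡 n) f x₀ y₀) (α : Fin m) :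
    matDeriv I α (fun v ↦ metricMatrix (𝓡 n) y₀ (localExpr I (𝓡 n) f x₀ y₀ v)) u
      = (pullbackMatrix I (𝓡 n) f x₀ y₀ α u)ᵀ * metricMatrix (𝓡 n) y₀ (localExpr I (𝓡 n) f x₀ y₀ u)
        + metricMatrix (𝓡 n) y₀ (localExpr I (𝓡 n) f x₀ y₀ u)
          * pullbackMatrix I (𝓡 n) f x₀ y₀ α u := by
  set w := localExpr I (𝓡 n) f x₀ y₀ u
  ext i j
  have h1 (l : Fin n) := congrFun (congrFun
    (matDeriv_metricMatrix (localExpr_mem_target hu) l) i) j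
  simp only [matDeriv_apply, Matrix.add_apply, Matrix.mul_apply, Matrix.transpose_apply] at h1
  rw [matDeriv_apply, pderiv_comp_localExpr hf (matSmooth_metricMatrix y₀ i j) hu]
  simp only [h1, Matrix.add_apply, Matrix.mul_apply, Matrix.transpose_apply, pullbackMatrix,
    Matrix.of_apply, Finset.sum_mul, Finset.mul_sum, add_mul, Finset.sum_add_distrib]
  congr 1
  · rw [Finset.sum_comm]
    exact Finset.sum_congr rfl fun p _ ↦ Finset.sum_congr rfl fun l _ ↦ mul_right_comm _ _ _
  · rw [Finset.sum_comm]
    exact Finset.sum_congr rfl fun p _ ↦ Finset.sum_congr rfl fun l _ ↦ mul_assoc _ _ _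

/-- The curvature of the pullback connection. -/
theorem curvMatrix_pullbackMatrix (hf : ContMDiff I (𝓡 n) ∞ f)
    (hu : u ∈ mapDomain I (𝓡 n) f x₀ y₀) (α β : Fin m) (k j : Fin n) :
    curvMatrix I (pullbackMatrix I (𝓡 n) f x₀ y₀) α β u k j
      = ∑ i, ∑ l, dfMatrix I (𝓡 n) f x₀ y₀ u i α * dfMatrix I (𝓡 n) f x₀ y₀ u l β *
        curvatureCoeff (𝓡 n) y₀ k j i l (localExpr I (𝓡 n) f x₀ y₀ u) := by
  have hU := relOpen_mapDomain (x₀ := x₀) (y₀ := y₀) hf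
  set w := localExpr I (𝓡 n) f x₀ y₀ u
  set φ := dfMatrix I (𝓡 n) f x₀ y₀ with hφ
  set Γ := christoffelMatrix (𝓡 n) y₀ with hΓ
  -- Differentiating `Γ_l(f) ∂_β f^l` gives derivatives of `Γ` along `f` and a term with `∂_α ∂_β
  -- f^l`. The latter is symmetric in `α, β` (`hsymm`) and drops out of the curvature.
  have hder (α β : Fin m) : pderiv I α (fun v ↦ pullbackMatrix I (𝓡 n) f x₀ y₀ β v k j) u
      = (∑ i, ∑ l, φ u i α * φ u l β * pderiv (𝓡 n) i (fun v ↦ Γ l v k j) w)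
        + ∑ l, Γ l w k j * pderiv I α (fun v ↦ φ v l β) u := by
    simp only [pullbackMatrix, Matrix.of_apply]
    rw [pderiv_sum hU (fun l _ ↦ (matSmooth_christoffel_comp hf l k j).mul
      (matSmooth_dfMatrix hf l β)) hu, Finset.sum_comm, ← Finset.sum_add_distrib]
    refine Finset.sum_congr rfl fun l _ ↦ ?_
    rw [pderiv_mul hU (matSmooth_christoffel_comp hf l k j) (matSmooth_dfMatrix hf l β) hu,
      pderiv_comp_localExpr hf (matSmooth_christoffelMatrix l k j) hu, Finset.sum_mul]
    congr 1
    exact Finset.sum_congr rfl fun i _ ↦ by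
      change _ * φ u i α * _ = _
      ring
  have hmul (α β : Fin m) :
      (pullbackMatrix I (𝓡 n) f x₀ y₀ α u * pullbackMatrix I (𝓡 n) f x₀ y₀ β u) k j
      = ∑ i, ∑ l, φ u i α * φ u l β * ∑ p, Γ i w k p * Γ l w p j := by
    rw [Matrix.mul_apply]
    simp only [pullbackMatrix, Matrix.of_apply, Finset.sum_mul_sum]
    simp only [Finset.mul_sum]
    refine Eq.trans ?_ Finset.sum_comm_cycle.symm
    exact Finset.sum_congr rfl fun p _ ↦ Finset.sum_congr rfl fun i _ ↦
      Finset.sum_congr rfl fun l _ ↦ by ring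
  have hsw (F : Fin n → Fin n → ℝ) : ∑ i, ∑ l, φ u i β * φ u l α * F i l
      = ∑ i, ∑ l, φ u i α * φ u l β * F l i := by
    rw [Finset.sum_comm]
    exact Finset.sum_congr rfl fun i _ ↦ Finset.sum_congr rfl fun l _ ↦ by ring
  have hsymm (l : Fin n) : pderiv I α (fun v ↦ φ v l β) u = pderiv I β (fun v ↦ φ v l α) u :=
    pderiv_dfMatrix_symm hf hu l α β
  simp only [curvMatrix, Matrix.add_apply, Matrix.sub_apply, matDeriv_apply, hder, hmul, hsymm]
  rw [hsw, hsw, add_sub_add_right_eq_sub]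
  simp only [← Finset.sum_add_distrib, ← Finset.sum_sub_distrib, ← mul_sub, ← mul_add]
  refine Finset.sum_congr rfl fun i _ ↦ Finset.sum_congr rfl fun l _ ↦ ?_
  simp only [curvatureCoeff]
  rfl

end Pullback

/-! ## Traces over orthonormal bases and the Bochner formula -/

section Traces

open Matrix Set Filter Topology

/-! ### Contracting quadratic expressions over an orthonormal basis. -/

section

variable {m : ℕ} {ι : Type*} [Fintype ι] {p : ι → Fin m → ℝ} {g : Matrix (Fin m) (Fin m) ℝ}

theorem sum_dotProduct_mulVec (hp : ∀ α β, ∑ a, p a α * p a β = g α β)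
    (q : Matrix (Fin m) (Fin m) ℝ) :
    ∑ a, p a ⬝ᵥ q *ᵥ p a = ∑ α, ∑ β, g α β * q α β := by
  simp only [dotProduct, mulVec, Finset.mul_sum, ← hp, Finset.sum_mul]
  rw [Finset.sum_comm]
  refine Finset.sum_congr rfl fun α _ ↦ ?_
  rw [Finset.sum_comm]
  exact Finset.sum_congr rfl fun β _ ↦ Finset.sum_congr rfl fun a _ ↦ by ring

theorem mulVec_dotProduct_mulVec_mulVec {b : Type*} [Fintype b] (X Y : Matrix b (Fin m) ℝ)
    (h : Matrix b b ℝ) (v w : Fin m → ℝ) :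
    (X *ᵥ v) ⬝ᵥ h *ᵥ (Y *ᵥ w) = v ⬝ᵥ (Xᵀ * h * Y) *ᵥ w := by
  rw [← Matrix.mulVec_mulVec, ← Matrix.mulVec_mulVec, Matrix.dotProduct_mulVec v Xᵀ,
    Matrix.vecMul_transpose]

theorem sum_mulVec_dotProduct_mulVec (hp : ∀ α β, ∑ a, p a α * p a β = g α β)
    {b : Type*} [Fintype b] (X Y : Matrix b (Fin m) ℝ) (h : Matrix b b ℝ) :
    ∑ a, (X *ᵥ p a) ⬝ᵥ h *ᵥ (Y *ᵥ p a) = (Xᵀ * h * Y * g).trace := by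
  have hg (α β) : g α β = g β α := by
    rw [← hp, ← hp]
    exact Finset.sum_congr rfl fun a _ ↦ mul_comm _ _
  simp only [mulVec_dotProduct_mulVec_mulVec]
  rw [sum_dotProduct_mulVec hp]
  simp only [Matrix.trace, Matrix.diag_apply, Matrix.mul_apply (N := g)]
  exact Finset.sum_congr rfl fun α _ ↦ Finset.sum_congr rfl fun β _ ↦ by rw [hg, mul_comm]

end

variable {m n : ℕ} {H : Type*} [TopologicalSpace H]
  {I : ModelWithCorners ℝ (EuclideanSpace ℝ (Fin m)) H}
  {M : Type*} [TopologicalSpace M] [ChartedSpace H M]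

theorem inner_eq_dotProduct [IsManifold I 1 M] [RiemannianBundle (fun x : M ↦ TangentSpace I x)]
    {x₀ x : M} (hx : x ∈ (chartAt H x₀).source) (X Y : TangentSpace I x) :
    inner ℝ X Y = coordComp I x₀ x X ⬝ᵥ
      metricMatrix I x₀ (extChartAt I x₀ x) *ᵥ coordComp I x₀ x Y := by
  conv_lhs => rw [← sum_coordComp_smul_coordVec hx X, ← sum_coordComp_smul_coordVec hx Y]
  simp only [sum_inner, inner_sum, inner_smul_left, inner_smul_right, ← metricMatrix_apply hx,
    dotProduct, mulVec, Finset.mul_sum]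
  rw [Finset.sum_comm]
  exact Finset.sum_congr rfl fun α _ ↦ Finset.sum_congr rfl fun β _ ↦ by
    simp
    ring

theorem coordComp_sum_smul_coordVec [IsManifold I 1 M] {x₀ x : M}
    (hx : x ∈ (chartAt H x₀).source) (c : Fin m → ℝ) :
    coordComp I x₀ x (∑ γ, c γ • coordVec I x₀ x γ) = c := by
  ext α
  simp [coordComp_sum, coordComp_smul, coordComp_coordVec hx]

variable {N : Type*} [TopologicalSpace N] [ChartedSpace (EuclideanSpace ℝ (Fin n)) N]
  {f : M → N} [IsManifold I ∞ M] [IsManifold (𝓡 n) ∞ N]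

theorem coordComp_mfderiv (hf : ContMDiff I (𝓡 n) ∞ f) {x₀ x : M} {y₀ : N}
    (hx : x ∈ (chartAt H x₀).source)
    (hy : f x ∈ (chartAt (EuclideanSpace ℝ (Fin n)) y₀).source) (X : TangentSpace I x) :
    coordComp (𝓡 n) y₀ (f x) (mfderiv I (𝓡 n) f x X)
      = dfMatrix I (𝓡 n) f x₀ y₀ (extChartAt I x₀ x) *ᵥ coordComp I x₀ x X := by
  conv_lhs => rw [← sum_coordComp_smul_coordVec hx X, map_sum]
  ext k
  rw [coordComp_sum]
  simp only [map_smul, coordComp_smul, coordComp_mfderiv_coordVec hf hx hy, mulVec, dotProduct]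
  exact Finset.sum_congr rfl fun α _ ↦ mul_comm _ _

variable [RiemannianBundle (fun x : M ↦ TangentSpace I x)]
  [RiemannianBundle (fun y : N ↦ TangentSpace (𝓡 n) y)]

/-- The basis enters only through `∑ e_a ⊗ e_a`, the inverse metric. The charts need only contain
`x` and `f x`, so one formula serves a whole neighbourhood and can be differentiated. -/
theorem energyDensity_eq (hf : ContMDiff I (𝓡 n) ∞ f) {x₀ x : M} {y₀ : N}
    (hx : x ∈ (chartAt H x₀).source)
    (hy : f x ∈ (chartAt (EuclideanSpace ℝ (Fin n)) y₀).source) :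
    energyDensity I (𝓡 n) f x = 1 / 2 *
      ((dfMatrix I (𝓡 n) f x₀ y₀ (extChartAt I x₀ x))ᵀ
        * metricMatrix (𝓡 n) y₀ (extChartAt (𝓡 n) y₀ (f x))
        * dfMatrix I (𝓡 n) f x₀ y₀ (extChartAt I x₀ x)
        * invMetricMatrix I x₀ (extChartAt I x₀ x)).trace := by
  have : FiniteDimensional ℝ (TangentSpace I x) :=
    inferInstanceAs (FiniteDimensional ℝ (EuclideanSpace ℝ (Fin m)))
  unfold energyDensity
  rw [← sum_mulVec_dotProduct_mulVec (sum_coordComp_mul_coordComp hx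
    (stdOrthonormalBasis ℝ (TangentSpace I x)))]
  congr 1
  refine Finset.sum_congr rfl fun a _ ↦ ?_
  rw [← real_inner_self_eq_norm_sq, inner_eq_dotProduct hy, coordComp_mfderiv hf hx hy]

theorem nablaDfNormSq_eq {x : M} :
    nablaDfNormSq I (𝓡 n) f x = ∑ ρ, ∑ σ, invMetricMatrix I x (extChartAt I x x) ρ σ *
      ((matCovDeriv I (pullbackMatrix I (𝓡 n) f x (f x)) (christoffelMatrix I x) σ
          (dfMatrix I (𝓡 n) f x (f x)) (extChartAt I x x))ᵀ
        * metricMatrix (𝓡 n) (f x) (extChartAt (𝓡 n) (f x) (f x))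
        * matCovDeriv I (pullbackMatrix I (𝓡 n) f x (f x)) (christoffelMatrix I x) ρ
          (dfMatrix I (𝓡 n) f x (f x)) (extChartAt I x x)
        * invMetricMatrix I x (extChartAt I x x)).trace := by
  have : FiniteDimensional ℝ (TangentSpace I x) :=
    inferInstanceAs (FiniteDimensional ℝ (EuclideanSpace ℝ (Fin m)))
  have hx := mem_chart_source H x
  have hy := mem_chart_source (EuclideanSpace ℝ (Fin n)) (f x)
  set B := fun α ↦ matCovDeriv I (pullbackMatrix I (𝓡 n) f x (f x)) (christoffelMatrix I x) α
    (dfMatrix I (𝓡 n) f x (f x)) (extChartAt I x x) with hB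
  set e := stdOrthonormalBasis ℝ (TangentSpace I x) with he
  set h := metricMatrix (𝓡 n) (f x) (extChartAt (𝓡 n) (f x) (f x))
  set g := invMetricMatrix I x (extChartAt I x x) with hg
  have hp : ∀ α β, ∑ a, coordComp I x x (e a) α * coordComp I x x (e a) β = g α β :=
    sum_coordComp_mul_coordComp hx e
  have h1 (X Y : TangentSpace I x) : coordComp (𝓡 n) (f x) (f x) (nablaDf I (𝓡 n) f x X Y)
      = (∑ α, coordComp I x x X α • B α) *ᵥ coordComp I x x Y := by
    rw [nablaDf, coordComp_sum_smul_coordVec hy]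
    ext k
    simp only [← matCovDeriv_dfMatrix, mulVec, dotProduct, Matrix.sum_apply, Matrix.smul_apply,
      smul_eq_mul, Finset.sum_mul]
    rw [Finset.sum_comm]
    exact Finset.sum_congr rfl fun β _ ↦ Finset.sum_congr rfl fun α _ ↦ mul_right_comm _ _ _
  -- Summing over the second basis vector gives a trace; what is left is a quadratic form in the
  -- first, contracted in turn by `sum_dotProduct_mulVec`.
  have h2 (a) : ∑ b, ‖nablaDf I (𝓡 n) f x (e a) (e b)‖ ^ 2
      = coordComp I x x (e a) ⬝ᵥ (Matrix.of fun ρ σ ↦ ((B σ)ᵀ * h * B ρ * g).trace) *ᵥ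
          coordComp I x x (e a) := by
    simp only [← real_inner_self_eq_norm_sq, inner_eq_dotProduct hy, h1]
    rw [sum_mulVec_dotProduct_mulVec hp]
    simp only [Matrix.transpose_sum, Matrix.transpose_smul, Matrix.sum_mul, Matrix.mul_sum,
      Matrix.smul_mul, Matrix.mul_smul, Matrix.trace_sum, Matrix.trace_smul, smul_eq_mul,
      dotProduct, mulVec, Matrix.of_apply, Finset.mul_sum]
    exact Finset.sum_congr rfl fun β _ ↦ Finset.sum_congr rfl fun α _ ↦ by ring
  unfold nablaDfNormSq
  rw [Finset.sum_congr rfl fun a _ ↦ h2 a, sum_dotProduct_mulVec hp]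
  rfl

theorem curvMatrix_antisymm {a : Type*} [Fintype a]
    (A : Fin m → EuclideanSpace ℝ (Fin m) → Matrix a a ℝ) (α β : Fin m)
    (u : EuclideanSpace ℝ (Fin m)) : curvMatrix I A α β u = -curvMatrix I A β α u := by
  simp only [curvMatrix]
  abel

theorem sum_inner_ricci (hf : ContMDiff I (𝓡 n) ∞ f) {x : M} {ι : Type*} [Fintype ι]
    (e : OrthonormalBasis ι ℝ (TangentSpace I x)) :
    ∑ a, inner ℝ (mfderiv I (𝓡 n) f x (ricci I x (e a))) (mfderiv I (𝓡 n) f x (e a))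
      = ∑ i, ∑ α, (∑ ρ, ∑ σ, invMetricMatrix I x (extChartAt I x x) ρ σ *
          (dfMatrix I (𝓡 n) f x (f x) (extChartAt I x x) *
            curvMatrix I (christoffelMatrix I x) α ρ (extChartAt I x x)) i σ) *
        (metricMatrix (𝓡 n) (f x) (extChartAt (𝓡 n) (f x) (f x))
          * dfMatrix I (𝓡 n) f x (f x) (extChartAt I x x)
          * invMetricMatrix I x (extChartAt I x x)) i α := by
  have hx := mem_chart_source H x
  have hy := mem_chart_source (EuclideanSpace ℝ (Fin n)) (f x)
  set φ := dfMatrix I (𝓡 n) f x (f x) (extChartAt I x x)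
  set h := metricMatrix (𝓡 n) (f x) (extChartAt (𝓡 n) (f x) (f x))
  set g := invMetricMatrix I x (extChartAt I x x) with hg
  have hp : ∀ α β, ∑ a, coordComp I x x (e a) α * coordComp I x x (e a) β = g α β :=
    sum_coordComp_mul_coordComp hx e
  -- `R` is the matrix of the Ricci operator in the chart.
  set R : Matrix (Fin m) (Fin m) ℝ := Matrix.of fun γ α ↦ ∑ ρ, ∑ σ, g ρ σ *
    curvMatrix I (christoffelMatrix I x) α ρ (extChartAt I x x) γ σ with hR
  have hcurv (X : TangentSpace I x) (ρ σ γ : Fin m) :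
      coordComp I x x (curvature I x X (coordVec I x x ρ) (coordVec I x x σ)) γ
        = ∑ α, coordComp I x x X α * curvatureCoeff I x γ σ α ρ (extChartAt I x x) := by
    rw [curvature, coordComp_sum_smul_coordVec hx]
    simp only [coordComp_coordVec hx]
    rw [Finset.sum_eq_single σ (fun δ _ hδ ↦ by simp [hδ]) (by simp)]
    simp
  have h1 (X : TangentSpace I x) : coordComp I x x (ricci I x X) = R *ᵥ coordComp I x x X := by
    ext γ
    simp only [ricci, coordComp_sum, coordComp_smul, hcurv, hR, mulVec, dotProduct,
      Matrix.of_apply, curvMatrix_christoffelMatrix, Finset.sum_mul, Finset.mul_sum]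
    exact Finset.sum_comm_cycle.trans <| Finset.sum_congr rfl fun α _ ↦
      Finset.sum_congr rfl fun ρ _ ↦ Finset.sum_congr rfl fun σ _ ↦ by
        rw [← hg]
        ring
  have h2 (i α) : (φ * R) i α = ∑ ρ, ∑ σ, g ρ σ *
      (φ * curvMatrix I (christoffelMatrix I x) α ρ (extChartAt I x x)) i σ := by
    simp only [Matrix.mul_apply, hR, Matrix.of_apply, Finset.mul_sum]
    refine Eq.trans ?_ Finset.sum_comm_cycle.symm
    exact Finset.sum_congr rfl fun γ _ ↦ Finset.sum_congr rfl fun ρ _ ↦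
      Finset.sum_congr rfl fun σ _ ↦ mul_left_comm _ _ _
  simp only [← h2, ← trace_transpose_mul_mul_mul]
  rw [← sum_mulVec_dotProduct_mulVec hp]
  refine Finset.sum_congr rfl fun a _ ↦ ?_
  rw [inner_eq_dotProduct hy, coordComp_mfderiv hf hx hy, coordComp_mfderiv hf hx hy, h1,
    Matrix.mulVec_mulVec]

theorem sum_inner_curvature [IsContMDiffRiemannianBundle (𝓡 n) ∞ (EuclideanSpace ℝ (Fin n))
      (fun y : N ↦ TangentSpace (𝓡 n) y)] (hf : ContMDiff I (𝓡 n) ∞ f) {x : M} {ι : Type*}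
    [Fintype ι] (e : OrthonormalBasis ι ℝ (TangentSpace I x)) :
    ∑ a, ∑ b, inner ℝ (curvature (𝓡 n) (f x) (mfderiv I (𝓡 n) f x (e a))
        (mfderiv I (𝓡 n) f x (e b)) (mfderiv I (𝓡 n) f x (e b))) (mfderiv I (𝓡 n) f x (e a))
      = ∑ i, ∑ α, (∑ ρ, ∑ σ, invMetricMatrix I x (extChartAt I x x) ρ σ *
          (curvMatrix I (pullbackMatrix I (𝓡 n) f x (f x)) α ρ (extChartAt I x x)
            * dfMatrix I (𝓡 n) f x (f x) (extChartAt I x x)) i σ) *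
        (metricMatrix (𝓡 n) (f x) (extChartAt (𝓡 n) (f x) (f x))
          * dfMatrix I (𝓡 n) f x (f x) (extChartAt I x x)
          * invMetricMatrix I x (extChartAt I x x)) i α := by
  have hx := mem_chart_source H x
  have hy := mem_chart_source (EuclideanSpace ℝ (Fin n)) (f x)
  have hu := mem_mapDomain (I := I) (f := f) hx hy
  have hw : localExpr I (𝓡 n) f x (f x) (extChartAt I x x) = extChartAt (𝓡 n) (f x) (f x) := by
    simp only [localExpr, extChartAt_to_inv]
  have hcurv := curvMatrix_pullbackMatrix hf hu
  rw [hw] at hcurv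
  set φ := dfMatrix I (𝓡 n) f x (f x) (extChartAt I x x)
  set h := metricMatrix (𝓡 n) (f x) (extChartAt (𝓡 n) (f x) (f x))
  set g := invMetricMatrix I x (extChartAt I x x) with hg
  set p := fun a ↦ coordComp I x x (e a) with hp_def
  set F := fun α ρ ↦ curvMatrix I (pullbackMatrix I (𝓡 n) f x (f x)) α ρ (extChartAt I x x)
    with hF
  have hp : ∀ α β, ∑ a, p a α * p a β = g α β := sum_coordComp_mul_coordComp hx e
  -- `S` represents `X ↦ ∑_b R^N(df X, df e_b) df e_b`, the counterpart on `N` of the Ricci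
  -- operator.
  set S : Matrix (Fin n) (Fin m) ℝ := Matrix.of fun k α ↦ ∑ ρ, ∑ σ, g ρ σ * (F α ρ * φ) k σ
    with hS
  have hdf (X : TangentSpace I x) : coordComp (𝓡 n) (f x) (f x) (mfderiv I (𝓡 n) f x X)
      = φ *ᵥ coordComp I x x X := coordComp_mfderiv hf hx hy X
  have h1 (X Y Z : TangentSpace I x) (k : Fin n) : coordComp (𝓡 n) (f x) (f x)
      (curvature (𝓡 n) (f x) (mfderiv I (𝓡 n) f x X) (mfderiv I (𝓡 n) f x Y)
        (mfderiv I (𝓡 n) f x Z)) k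
      = ∑ j, (coordComp I x x X ⬝ᵥ (Matrix.of fun α ρ ↦ F α ρ k j) *ᵥ coordComp I x x Y)
        * (φ *ᵥ coordComp I x x Z) j := by
    rw [curvature, coordComp_sum_smul_coordVec hy]
    simp only [hdf]
    refine Finset.sum_congr rfl fun j _ ↦ ?_
    have h3 : (Matrix.of fun α ρ ↦ F α ρ k j) = φᵀ * (Matrix.of fun i l ↦
        curvatureCoeff (𝓡 n) (f x) k j i l (extChartAt (𝓡 n) (f x) (f x))) * φ := by
      ext α ρ
      simp only [Matrix.of_apply, hF, hcurv, Matrix.mul_apply, Matrix.transpose_apply,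
        Finset.sum_mul]
      rw [Finset.sum_comm]
      exact Finset.sum_congr rfl fun l _ ↦ Finset.sum_congr rfl fun i _ ↦ mul_right_comm _ _ _
    rw [h3, ← mulVec_dotProduct_mulVec_mulVec]
    generalize φ *ᵥ coordComp I x x X = y
    generalize φ *ᵥ coordComp I x x Y = z
    generalize (φ *ᵥ coordComp I x x Z) j = c
    simp only [dotProduct, mulVec, Matrix.of_apply, Finset.mul_sum, Finset.sum_mul]
    exact Finset.sum_congr rfl fun l _ ↦ Finset.sum_congr rfl fun i _ ↦ by ring
  have h2 (X : TangentSpace I x) : coordComp (𝓡 n) (f x) (f x)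
      (∑ b, curvature (𝓡 n) (f x) (mfderiv I (𝓡 n) f x X) (mfderiv I (𝓡 n) f x (e b))
        (mfderiv I (𝓡 n) f x (e b))) = S *ᵥ coordComp I x x X := by
    ext k
    rw [coordComp_sum]
    simp only [h1]
    rw [Finset.sum_comm]
    have h3 (j : Fin n) : ∑ b, (coordComp I x x X ⬝ᵥ (Matrix.of fun α ρ ↦ F α ρ k j) *ᵥ
        coordComp I x x (e b)) * (φ *ᵥ coordComp I x x (e b)) j
        = ∑ ρ, ∑ σ, g ρ σ * ((∑ α, coordComp I x x X α * F α ρ k j) * φ j σ) := by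
      -- For fixed `j` the summand is a product of two linear forms in `p b`, hence the quadratic
      -- form of a rank-one matrix.
      refine Eq.trans (Finset.sum_congr rfl fun b _ ↦ ?_) (sum_dotProduct_mulVec hp
        (Matrix.vecMulVec (coordComp I x x X ᵥ* Matrix.of fun α ρ ↦ F α ρ k j) (φ j)))
      rw [Matrix.dotProduct_mulVec, Matrix.vecMulVec_mulVec, dotProduct_smul, op_smul_eq_smul,
        smul_eq_mul, mul_comm, dotProduct_comm (p b)]
      rfl
    rw [Finset.sum_congr rfl fun j _ ↦ h3 j]
    simp only [mulVec, dotProduct, hS, Matrix.of_apply, Matrix.mul_apply, Finset.sum_mul,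
      Finset.mul_sum]
    rw [← Finset.sum_comm_cycle]
    refine Eq.trans (Finset.sum_congr rfl fun ρ _ ↦ Finset.sum_congr rfl fun σ _ ↦
      Finset.sum_comm) (Finset.sum_comm_cycle.trans ?_)
    exact Finset.sum_congr rfl fun α _ ↦ Finset.sum_congr rfl fun ρ _ ↦
      Finset.sum_congr rfl fun σ _ ↦ Finset.sum_congr rfl fun j _ ↦ by ring
  simp only [← sum_inner]
  change _ = ∑ i, ∑ α, S i α * (h * φ * g) i α
  rw [← trace_transpose_mul_mul_mul, ← sum_mulVec_dotProduct_mulVec hp]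
  refine Finset.sum_congr rfl fun a _ ↦ ?_
  rw [inner_eq_dotProduct hy, hdf, h2]

end Traces

/-! ### Smoothness of the energy density and the Bochner formula. -/

section Energy

open Matrix Set Filter Topology

variable {m n : ℕ} {H : Type*} [TopologicalSpace H]
  {I : ModelWithCorners ℝ (EuclideanSpace ℝ (Fin m)) H}
  {M : Type*} [TopologicalSpace M] [ChartedSpace H M] [IsManifold I ∞ M]
  [RiemannianBundle (fun x : M ↦ TangentSpace I x)]
  [IsContMDiffRiemannianBundle I ∞ (EuclideanSpace ℝ (Fin m)) (fun x : M ↦ TangentSpace I x)]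
  {N : Type*} [TopologicalSpace N] [ChartedSpace (EuclideanSpace ℝ (Fin n)) N]
  [IsManifold (𝓡 n) ∞ N] [RiemannianBundle (fun y : N ↦ TangentSpace (𝓡 n) y)]
  [IsContMDiffRiemannianBundle (𝓡 n) ∞ (EuclideanSpace ℝ (Fin n))
    (fun y : N ↦ TangentSpace (𝓡 n) y)] {f : M → N}

omit [IsContMDiffRiemannianBundle I ∞ (EuclideanSpace ℝ (Fin m)) (fun x : M ↦ TangentSpace I x)]
  [IsContMDiffRiemannianBundle (𝓡 n) ∞ (EuclideanSpace ℝ (Fin n))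
    (fun y : N ↦ TangentSpace (𝓡 n) y)] in
theorem energyDensity_extChartAt_symm (hf : ContMDiff I (𝓡 n) ∞ f) {x₀ : M} {y₀ : N}
    {u : EuclideanSpace ℝ (Fin m)} (hu : u ∈ mapDomain I (𝓡 n) f x₀ y₀) :
    energyDensity I (𝓡 n) f ((extChartAt I x₀).symm u) = 1 / 2 *
      ((dfMatrix I (𝓡 n) f x₀ y₀ u)ᵀ * metricMatrix (𝓡 n) y₀ (localExpr I (𝓡 n) f x₀ y₀ u)
        * dfMatrix I (𝓡 n) f x₀ y₀ u * invMetricMatrix I x₀ u).trace := by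
  have hx : (extChartAt I x₀).symm u ∈ (chartAt H x₀).source := by
    rw [← extChartAt_source I]
    exact (extChartAt I x₀).map_target hu.1
  have hy := hu.2
  rw [mem_ofPred_eq, extChartAt_source] at hy
  rw [energyDensity_eq hf hx hy, (extChartAt I x₀).right_inv hu.1]
  rfl

theorem smoothIn_energyDensity (hf : ContMDiff I (𝓡 n) ∞ f) (x₀ : M) (y₀ : N) :
    SmoothIn I (mapDomain I (𝓡 n) f x₀ y₀)
      (fun u ↦ energyDensity I (𝓡 n) f ((extChartAt I x₀).symm u)) := by
  have hφ := matSmooth_dfMatrix (x₀ := x₀) (y₀ := y₀) hf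
  have hg : MatSmooth I (mapDomain I (𝓡 n) f x₀ y₀) (invMetricMatrix I x₀) :=
    fun i j v hv ↦ matSmooth_invMetricMatrix x₀ i j v hv.1
  exact ((SmoothIn.const (1 / 2)).mul
    (((hφ.transpose.mul (matSmooth_metricMatrix_comp hf)).mul hφ).mul hg).trace).congr
    (relOpen_mapDomain hf) fun v hv ↦ energyDensity_extChartAt_symm hf hv

theorem contMDiff_energyDensity (hf : ContMDiff I (𝓡 n) ∞ f) :
    ContMDiff I 𝓘(ℝ, ℝ) ∞ (energyDensity I (𝓡 n) f) := fun x ↦ by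
  have hu := mem_mapDomain (I := I) (f := f) (mem_chart_source H x)
    (mem_chart_source (EuclideanSpace ℝ (Fin n)) (f x))
  have h1 : ContMDiffAt I 𝓘(ℝ, ℝ) ∞ ((fun u ↦ energyDensity I (𝓡 n) f ((extChartAt I x).symm u))
      ∘ extChartAt I x) x :=
    (smoothIn_energyDensity hf x (f x) _ hu).contMDiffWithinAt.comp x
      (contMDiffAt_extChartAt (n := ∞)).contMDiffWithinAt (s := univ) fun y _ ↦ by simp
  refine h1.congr_of_eventuallyEq ?_
  filter_upwards [extChartAt_source_mem_nhds (I := I) x] with y hy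
  simp only [Function.comp_apply, (extChartAt I x).left_inv hy]

/-- The Bochner formula for the energy density of a harmonic map. -/
theorem IsHarmonicMap.laplacian_energyDensity (hf : IsHarmonicMap I (𝓡 n) f) (x : M)
    {ι : Type*} [Fintype ι] (e : OrthonormalBasis ι ℝ (TangentSpace I x)) :
    laplacian I (energyDensity I (𝓡 n) f) x = nablaDfNormSq I (𝓡 n) f x
      + ∑ α, inner ℝ (mfderiv I (𝓡 n) f x (ricci I x (e α))) (mfderiv I (𝓡 n) f x (e α))
      - ∑ α, ∑ β, inner ℝ
          (curvature (𝓡 n) (f x) (mfderiv I (𝓡 n) f x (e α))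
            (mfderiv I (𝓡 n) f x (e β)) (mfderiv I (𝓡 n) f x (e β)))
          (mfderiv I (𝓡 n) f x (e α)) := by
  have hfs := hf.contMDiff
  have hu := mem_mapDomain (I := I) (f := f) (mem_chart_source H x)
    (mem_chart_source (EuclideanSpace ℝ (Fin n)) (f x))
  have hU := relOpen_mapDomain (x₀ := x) (y₀ := f x) hfs
  have hw : localExpr I (𝓡 n) f x (f x) (extChartAt I x x) = extChartAt (𝓡 n) (f x) (f x) := by
    simp only [localExpr, extChartAt_to_inv]
  have hE := smoothIn_energyDensity hfs x (f x)
  have key := laplacian_trace_pairing (Γ := christoffelMatrix I x) (g := invMetricMatrix I x) hU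
    (matSmooth_pullbackMatrix hfs)
    (fun α i j v hv ↦ matSmooth_christoffelMatrix (x₀ := x) α i j v hv.1)
    (matSmooth_dfMatrix hfs) (fun i j v hv ↦ matSmooth_invMetricMatrix x i j v hv.1)
    (matSmooth_metricMatrix_comp hfs) (fun v _ ↦ invMetricMatrix_transpose x v)
    (fun v _ ↦ metricMatrix_transpose (f x) _) (fun α v hv ↦ matDeriv_metricMatrix_comp hfs hv α)
    (fun α v hv ↦ matDeriv_invMetricMatrix hv.1 α) (fun v _ α β γ ↦ christoffel_symm γ α β)
    (fun v hv α β i ↦ matCovDeriv_dfMatrix_symm hfs hv i α β)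
    (fun v hv i ↦ hf.sum_matCovDeriv_eq_zero hv i) hu
    (fun v hv ↦ energyDensity_extChartAt_symm hfs hv)
  -- The Laplacian is the divergence of the covector field `∂_τ e(f)`, so `divCoord_eq` brings it to
  -- the form of `key`.
  have hL : laplacian I (energyDensity I (𝓡 n) f) x = _ :=
    (divCoord_eq hU inter_subset_left (fun τ ↦ hE.pderiv hU τ) hu).trans key
  rw [hL, hw, ← nablaDfNormSq_eq, sum_inner_ricci hfs e, sum_inner_curvature hfs e, add_sub_assoc,
    ← Finset.sum_sub_distrib]
  congr 1
  refine Finset.sum_congr rfl fun i _ ↦ ?_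
  rw [← Finset.sum_sub_distrib]
  refine Finset.sum_congr rfl fun α _ ↦ ?_
  rw [← sub_mul, ← Finset.sum_sub_distrib]
  congr 1
  refine Finset.sum_congr rfl fun ρ _ ↦ ?_
  rw [← Finset.sum_sub_distrib]
  refine Finset.sum_congr rfl fun σ _ ↦ ?_
  -- The commutator produces curvature with arguments `(ρ, α)`, the contractions use `(α, ρ)`. The
  -- sign change makes the Ricci term positive and the `R^N` term negative.
  rw [curvMatrix_antisymm _ ρ α, curvMatrix_antisymm _ ρ α, Matrix.neg_mul, Matrix.mul_neg,
    Matrix.sub_apply, Matrix.neg_apply, Matrix.neg_apply]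
  ring

end Energy

end HarmonicMaps

end

theorem mainTheorem9 {m n : ℕ}
    {H : Type*} [TopologicalSpace H] (I : ModelWithCorners ℝ (EuclideanSpace ℝ (Fin m)) H)
    {M : Type*} [TopologicalSpace M] [ChartedSpace H M] [IsManifold I ∞ M]
    [RiemannianBundle (fun x : M ↦ TangentSpace I x)]
    [IsContMDiffRiemannianBundle I ∞ (EuclideanSpace ℝ (Fin m)) (fun x : M ↦ TangentSpace I x)]
    {N : Type*} [TopologicalSpace N] [ChartedSpace (EuclideanSpace ℝ (Fin n)) N]
    [IsManifold (𝓡 n) ∞ N]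
    [RiemannianBundle (fun y : N ↦ TangentSpace (𝓡 n) y)]
    [IsContMDiffRiemannianBundle (𝓡 n) ∞ (EuclideanSpace ℝ (Fin n))
      (fun y : N ↦ TangentSpace (𝓡 n) y)]
    (f : M → N) (hf : HarmonicMaps.IsHarmonicMap I (𝓡 n) f) :
    ContMDiff I 𝓘(ℝ, ℝ) ∞ (HarmonicMaps.energyDensity I (𝓡 n) f) ∧
    ∀ (x : M) (e : OrthonormalBasis (Fin m) ℝ (TangentSpace I x)),
      HarmonicMaps.laplacian I (HarmonicMaps.energyDensity I (𝓡 n) f) x =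
        HarmonicMaps.nablaDfNormSq I (𝓡 n) f x
        + ∑ α, inner ℝ (mfderiv I (𝓡 n) f x (HarmonicMaps.ricci I x (e α)))
            (mfderiv I (𝓡 n) f x (e α))
        - ∑ α, ∑ β, inner ℝ
            (HarmonicMaps.curvature (𝓡 n) (f x) (mfderiv I (𝓡 n) f x (e α))
              (mfderiv I (𝓡 n) f x (e β)) (mfderiv I (𝓡 n) f x (e β)))
            (mfderiv I (𝓡 n) f x (e α)) :=
  ⟨HarmonicMaps.contMDiff_energyDensity hf.contMDiff,
    fun x e ↦ hf.laplacian_energyDensity x e⟩
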